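/- Throughout, vector spaces are over $\mathbb{Z}_2$. A persistence module $V$ is a functor from $(\mathbb{R},\le)$ to vector spaces; for an interval $I\subseteq\mathbb{R}$, $\kappa_I$ is the interval module of $I$ (equal to $\mathbb{Z}_2$ on $I$ and $0$ elsewhere, with identity maps inside $I$), and $\kappa_b=\kappa_{[0,b)}$, $\kappa_\infty=\kappa_{[0,\infty)}$. For a finite metric space $Z$, $\mathrm{PH}_0(Z)_t$ is, for $t\ge 0$, the free vector space on the connected components of the graph on $Z$ with an edge between $x\neq y$ whenever $d(x,y)\le t$, and it is $0$ for $t<0$. The barcode of a persistence module $W$ is the (unique) function $m^W$ on bounded intervals $J=[a,b)$, $a<b$, with values in $\mathbb{Z}_{\ge 0}$, such that $W$ is isomorphic to the direct sum of $m^W(J)$ copies of $\kappa_J$ over all $J$ and of finitely many copies of $\kappa_\infty$; the interval $[0,\infty)$ is not recorded in the barcode. Let $X$ and $Z$ be finite metric spaces with $X\neq\emptyset$, and let $f\colon V=\mathrm{PH}_0(X)\to U=\mathrm{PH}_0(Z)$ be the persistence morphism induced by an injective map $f_\bullet\colon X\to Z$ such that $d_Z(f_\bullet(x),f_\bullet(y))\le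 d_X(x,y)$ for all $x,y\in X$. Let $f_0\colon V_0\to U_0$ be its component at $0$. For $W\in\{V,U\}$ and $b>0$ put $\ker_b^+(W)=\ker(W_0\to W_b)$ and $\ker_b^-(W)=\bigcup_{0\le r<b}\ker(W_0\to W_r)$, and for $a,b>0$ let $$\mathcal{M}^0_f(a,b)=\dim\left(\frac{f_0(\ker_a^+(V))\cap\ker_b^+(U)}{f_0(\ker_a^-(V))\cap\ker_b^+(U)+f_0(\ker_a^+(V))\cap\ker_b^-(U)}\right),\qquad N_f(b)=m^U([0,b))-\sum_{a>0}\mathcal{M}^0_f(a,b).$$ The matching diagram $D(f_0)$ is the multiset of pairs $(a,b)\in(\mathbb{R}\cup\{\infty\})\times\mathbb{R}$ in which $(a,b)$ has multiplicity $m^D(a,b)=\mathcal{M}^0_f(a,b)$ for $0<a<\infty$ and $b>0$, $(\infty,b)$ has multiplicity $m^D(\infty,b)=N_f(b)$ for $b>0$, and all other pairs have multiplicity $0$. Then only finitely many pairs have nonzero multiplicity in $D(f_0)$, $N_f(b)\ge 0$ for all $b>0$, and there are isomorphisms $$\mathrm{im}(f)\simeq\Big(\bigoplus_{b>0}\bigoplus_{a\ge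 b}\kappa_b^{\oplus\mathcal{M}^0_f(a,b)}\Big)\oplus\kappa_\infty,\qquad \ker(f)\simeq\bigoplus_{b>0}\bigoplus_{a>b}\kappa_{[b,a)}^{\oplus\mathcal{M}^0_f(a,b)},\qquad \mathrm{coker}(f)\simeq\bigoplus_{b>0}\kappa_b^{\oplus N_f(b)}.$$ Moreover, $D(f_0)$ encodes the barcodes of $V$, $U$, $\ker(f)$, $\mathrm{im}(f)$ and $\mathrm{coker}(f)$: these five modules have barcodes, these are unique, the barcodes of $V$, $U$, $\mathrm{im}(f)$ and $\mathrm{coker}(f)$ contain only intervals that start at $0$, and $$m^V([0,a))=\sum_{b\le a}m^D(a,b),\qquad m^U([0,b))=\sum_{b\le a\le\infty}m^D(a,b),\qquad m^{\ker(f)}([b,a))=m^D(a,b),$$ $$m^{\mathrm{im}(f)}([0,b))=\sum_{b\le a<\infty}m^D(a,b),\qquad m^{\mathrm{coker}(f)}([0,b))=m^D(\infty,b),$$ where $a,b>0$ in the formulas for $V$, $U$, $\mathrm{im}(f)$ and $\mathrm{coker}(f)$, and where the formula for $\ker(f)$ holds for all real $b<a$. -/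

import Mathlib

open CategoryTheory

universe u

noncomputable section

namespace Persistence

/-! ### Persistence modules over the field with two elements -/

/-- A persistence module indexed by the ordered set of real numbers, over the field `ℤ/2`:
vector spaces `V.obj t` and functorial structure maps `V.obj s ⟶ V.obj t` for `s ≤ t`.
Morphisms and isomorphisms of persistence modules are natural ones. -/
abbrev PersistenceModule : Type (u + 1) := ℝ ⥤ ModuleCat.{u} (ZMod 2)

/-- The structure map of `V` from `s` to `t`, as a linear map. -/
def structureMap (V : PersistenceModule.{u}) {s t : ℝ} (h : s ≤ t) :
    V.obj s →ₗ[ZMod 2] V.obj t :=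
  (V.map (homOfLE h)).hom

/-- The space at `t` of the interval module of `S`: it is all of `ℤ/2` if `t ∈ S`, and `0`
otherwise. -/
def intervalSpace (S : Set ℝ) (t : ℝ) : Submodule (ZMod 2) (ULift.{u} (ZMod 2)) where
  carrier := {x | t ∉ S → x = 0}
  zero_mem' := fun _ => rfl
  add_mem' := fun {x y} hx hy ht => by rw [hx ht, hy ht, add_zero]
  smul_mem' := fun c x hx ht => by rw [hx ht, smul_zero]

open Classical in
/-- The structure map of the interval module of `S` from `s` to `t`: the identity of `ℤ/2` if both
`s` and `t` lie in `S`, and zero otherwise. -/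
def intervalMap (S : Set ℝ) (s t : ℝ) :
    intervalSpace.{u} S s →ₗ[ZMod 2] intervalSpace.{u} S t where
  toFun x := ⟨if t ∈ S then x.1 else 0, fun ht => if_neg ht⟩
  map_add' x y := by
    ext1
    by_cases ht : t ∈ S <;> simp [ht]
  map_smul' c x := by
    ext1
    by_cases ht : t ∈ S <;> simp [ht]

/-- The interval module of an interval (an order-connected set) `S` of real numbers. -/
def intervalModule (S : Set ℝ) [hS : S.OrdConnected] : PersistenceModule.{u} where
  obj t := ModuleCat.of (ZMod 2) (intervalSpace.{u} S t)
  map {s t} _ := ModuleCat.ofHom (intervalMap.{u} S s t)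
  map_id t := by
    refine ModuleCat.hom_ext (LinearMap.ext fun x => Subtype.ext ?_)
    by_cases ht : t ∈ S
    · simp [intervalMap, ht]
    · simp [intervalMap, ht, x.2 ht]
  map_comp {r s t} f g := by
    refine ModuleCat.hom_ext (LinearMap.ext fun x => Subtype.ext ?_)
    by_cases ht : t ∈ S
    · by_cases hr : r ∈ S
      · have hs : s ∈ S := hS.out hr ht ⟨leOfHom f, leOfHom g⟩
        simp [intervalMap, ht, hs]
      · simp [intervalMap, x.2 hr]
    · simp [intervalMap, ht]

/-- `κ_{[a,b)}`. -/
def kappaIco (a b : ℝ) : PersistenceModule.{u} := intervalModule (Set.Ico a b)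

/-- `κ_b = κ_{[0,b)}`. -/
def kappa (b : ℝ) : PersistenceModule.{u} := kappaIco 0 b

/-- `κ_∞`, the interval module of `[0,∞)`. -/
def kappaInfty : PersistenceModule.{u} := intervalModule (Set.Ici 0)

/-- The direct sum of a family of persistence modules, taken pointwise. -/
def directSum {ι : Type} (M : ι → PersistenceModule.{u}) : PersistenceModule.{u} where
  obj t := ModuleCat.of (ZMod 2) (DirectSum ι fun i => (M i).obj t)
  map {_ _} h := ModuleCat.ofHom (DirectSum.lmap fun i => ((M i).map h).hom)
  map_id t := by
    ext x
    simp
  map_comp f g := by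
    ext x
    simp [DirectSum.lmap_comp]

/-- The direct sum of two persistence modules, taken pointwise. -/
def directSumTwo (V W : PersistenceModule.{u}) : PersistenceModule.{u} where
  obj t := ModuleCat.of (ZMod 2) (V.obj t × W.obj t)
  map {_ _} h := ModuleCat.ofHom ((V.map h).hom.prodMap (W.map h).hom)
  map_id t := by
    ext x <;> simp
  map_comp f g := by
    ext x <;> simp

/-! ### Image, kernel and cokernel of a persistence morphism -/

variable {V U : PersistenceModule.{u}}

theorem naturality_apply (f : V ⟶ U) {s t : ℝ} (h : s ⟶ t) (x : V.obj s) :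
    (f.app t).hom ((V.map h).hom x) = (U.map h).hom ((f.app s).hom x) := by
  have := f.naturality h
  exact congrArg (fun g => g.hom x) this

/-- The kernel persistence module: `ker (f_t)` with the restricted structure maps of `V`. -/
def kerModule (f : V ⟶ U) : PersistenceModule.{u} where
  obj t := ModuleCat.of (ZMod 2) (LinearMap.ker (f.app t).hom)
  map {s t} h := ModuleCat.ofHom ((V.map h).hom.restrict
    (p := LinearMap.ker (f.app s).hom) (q := LinearMap.ker (f.app t).hom) (fun x hx => by
      rw [LinearMap.mem_ker] at hx ⊢
      rw [naturality_apply, hx, map_zero]))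
  map_id t := by
    refine ModuleCat.hom_ext (LinearMap.ext fun x => Subtype.ext ?_)
    simp
  map_comp f g := by
    refine ModuleCat.hom_ext (LinearMap.ext fun x => Subtype.ext ?_)
    simp

/-- The image persistence module: `im (f_t)` with the restricted structure maps of `U`. -/
def imModule (f : V ⟶ U) : PersistenceModule.{u} where
  obj t := ModuleCat.of (ZMod 2) (LinearMap.range (f.app t).hom)
  map {s t} h := ModuleCat.ofHom ((U.map h).hom.restrict
    (p := LinearMap.range (f.app s).hom) (q := LinearMap.range (f.app t).hom) (by
      rintro _ ⟨x, rfl⟩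
      exact ⟨(V.map h).hom x, naturality_apply f h x⟩))
  map_id t := by
    refine ModuleCat.hom_ext (LinearMap.ext fun x => Subtype.ext ?_)
    simp
  map_comp f g := by
    refine ModuleCat.hom_ext (LinearMap.ext fun x => Subtype.ext ?_)
    simp

/-- The cokernel persistence module: `U_t / im (f_t)` with the structure maps induced by those
of `U`. -/
def cokerModule (f : V ⟶ U) : PersistenceModule.{u} where
  obj t := ModuleCat.of (ZMod 2) (U.obj t ⧸ LinearMap.range (f.app t).hom)
  map {s t} h := ModuleCat.ofHom (Submodule.mapQ (LinearMap.range (f.app s).hom)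
    (LinearMap.range (f.app t).hom) (U.map h).hom (by
      rintro _ ⟨x, rfl⟩
      exact ⟨(V.map h).hom x, naturality_apply f h x⟩))
  map_id t := by
    refine ModuleCat.hom_ext (LinearMap.ext fun x => ?_)
    obtain ⟨y, rfl⟩ := Submodule.Quotient.mk_surjective _ x
    simp
  map_comp f g := by
    refine ModuleCat.hom_ext (LinearMap.ext fun x => ?_)
    obtain ⟨y, rfl⟩ := Submodule.Quotient.mk_surjective _ x
    simp

/-! ### Barcodes -/

/-- The bounded intervals `[left, right)` that are allowed in a barcode. -/
structure BarInterval where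
  left : ℝ
  right : ℝ
  lt : left < right

/-- `V` is the direct sum of `m J` copies of `κ_J`, over all bounded intervals `J = [a,b)`, and
of finitely many copies of `κ_∞`. -/
def HasIntervalDecomposition (V : PersistenceModule.{u}) (m : BarInterval → ℕ) : Prop :=
  ∃ k : ℕ, Nonempty (V ≅ directSumTwo
    (directSum fun i : (Σ J : BarInterval, Fin (m J)) => kappaIco.{u} i.1.left i.1.right)
    (directSum fun _ : Fin k => kappaInfty.{u}))

/-- `m` is the barcode of `V`, that is, the unique multiplicity function of an interval
decomposition of `V`. Following the convention that the infinite interval `[0,∞)` is not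
an element of the barcode, only bounded intervals are recorded. -/
def IsBarcode (V : PersistenceModule.{u}) (m : BarInterval → ℕ) : Prop :=
  HasIntervalDecomposition V m ∧ ∀ m', HasIntervalDecomposition V m' → m' = m

open Classical in
/-- The multiplicity function `m^V` of the barcode of `V` (and zero if `V` has no barcode). -/
def barcode (V : PersistenceModule.{u}) : BarInterval → ℕ :=
  if h : ∃ m, IsBarcode V m then h.choose else 0

/-! ### The block function and the matching diagram -/

open Classical in
/-- `ker⁺_b(U) = ker (U_0 → U_b)` for `b ≥ 0` (and `0` for negative `b`). -/
def kerPlus (U : PersistenceModule.{u}) (b : ℝ) : Submodule (ZMod 2) (U.obj 0) :=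
  if h : 0 ≤ b then LinearMap.ker (structureMap U h) else ⊥

/-- `ker⁻_b(U)`, the union of the increasing family of subspaces `ker (U_0 → U_r)`, `0 ≤ r < b`;
the union of a chain of subspaces is its supremum. -/
def kerMinus (U : PersistenceModule.{u}) (b : ℝ) : Submodule (ZMod 2) (U.obj 0) :=
  ⨆ (r : ℝ) (h : 0 ≤ r) (_ : r < b), LinearMap.ker (structureMap U h)

/-- The block function `M⁰_f(a,b)`, which depends only on the linear map `f₀ : V_0 → U_0`. -/
def blockFunction (f₀ : V.obj 0 →ₗ[ZMod 2] U.obj 0) (a b : ℝ) : ℕ :=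
  Module.finrank (ZMod 2)
    (↥((kerPlus V a).map f₀ ⊓ kerPlus U b) ⧸
      (((kerMinus V a).map f₀ ⊓ kerPlus U b) ⊔ ((kerPlus V a).map f₀ ⊓ kerMinus U b)).submoduleOf
        ((kerPlus V a).map f₀ ⊓ kerPlus U b))

/-- `N_f(b) = m^U([0,b)) - ∑_{a > 0} M⁰_f(a,b)` for `b > 0`. -/
def unmatched (f₀ : V.obj 0 →ₗ[ZMod 2] U.obj 0) (b : ℝ) : ℕ :=
  if hb : 0 < b then barcode U ⟨0, b, hb⟩ - ∑ᶠ (a : ℝ) (_ : 0 < a), blockFunction f₀ a b else 0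

/-- The multiplicity function of the matching diagram `D(f₀)` on `(ℝ ∪ {∞}) × ℝ`. -/
def matchingDiagram (f₀ : V.obj 0 →ₗ[ZMod 2] U.obj 0) : WithTop ℝ → ℝ → ℕ
  | (a : ℝ), b => blockFunction f₀ a b
  | ⊤, b => unmatched f₀ b

/-! ### Persistent homology in degree zero of the Vietoris-Rips filtration -/

/-- The map on connected components induced by a vertex map which sends each edge to an edge or
to a single vertex. -/
def componentMap {A B : Type*} {G : SimpleGraph A} {H : SimpleGraph B} (φ : A → B)
    (h : ∀ x y, G.Adj x y → φ x = φ y ∨ H.Adj (φ x) (φ y)) :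
    G.ConnectedComponent → H.ConnectedComponent :=
  SimpleGraph.ConnectedComponent.lift (fun x => H.connectedComponentMk (φ x)) (by
    intro x y p _
    induction p with
    | nil => rfl
    | cons hxy p ih =>
      refine Eq.trans ?_ (ih (SimpleGraph.Walk.IsPath.of_cons ‹_›))
      rcases h _ _ hxy with e | e
      · rw [e]
      · exact SimpleGraph.ConnectedComponent.sound e.reachable)

@[simp] theorem componentMap_mk {A B : Type*} {G : SimpleGraph A} {H : SimpleGraph B} (φ : A → B)
    (h : ∀ x y, G.Adj x y → φ x = φ y ∨ H.Adj (φ x) (φ y)) (x : A) :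
    componentMap φ h (G.connectedComponentMk x) = H.connectedComponentMk (φ x) := rfl

/-- The Vietoris-Rips graph of `Z` at scale `t`: for `t ≥ 0` its vertices are the points of `Z`,
and `x ≠ y` are joined by an edge when `dist x y ≤ t`; for `t < 0` it is empty. -/
def vrGraph (Z : Type u) [MetricSpace Z] (t : ℝ) : SimpleGraph {_x : Z // 0 ≤ t} where
  Adj x y := x ≠ y ∧ dist x.1 y.1 ≤ t
  symm := ⟨fun x y h => ⟨h.1.symm, by rw [dist_comm]; exact h.2⟩⟩
  loopless := ⟨fun _ h => h.1 rfl⟩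

/-- The map `π₀(VR_s(X)) → π₀(VR_t(Z))` induced by a non-expansive map, for `s ≤ t`. -/
def vrComponentMap {X Z : Type u} [MetricSpace X] [MetricSpace Z] (φ : X → Z)
    (hφ : ∀ x y, dist (φ x) (φ y) ≤ dist x y) {s t : ℝ} (h : s ≤ t) :
    (vrGraph X s).ConnectedComponent → (vrGraph Z t).ConnectedComponent :=
  componentMap (fun x => ⟨φ x.1, x.2.trans h⟩) (fun x y hxy => by
    by_cases e : φ x.1 = φ y.1
    · exact Or.inl (Subtype.ext e)
    · exact Or.inr ⟨fun e' => e (congrArg Subtype.val e'), (hφ _ _).trans (hxy.2.trans h)⟩)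

/-- `PH₀(Z)`: at `t`, the free `ℤ/2`-vector space on the connected components of `VR_t(Z)`, with
the maps induced by the inclusions of graphs. -/
def PH0 (Z : Type u) [MetricSpace Z] : PersistenceModule.{u} where
  obj t := ModuleCat.of (ZMod 2) ((vrGraph Z t).ConnectedComponent →₀ ZMod 2)
  map {_ _} h := ModuleCat.ofHom (Finsupp.lmapDomain (ZMod 2) (ZMod 2)
    (vrComponentMap (id : Z → Z) (fun _ _ => le_rfl) (leOfHom h)))
  map_id t := by
    have : vrComponentMap (id : Z → Z) (fun _ _ => le_rfl) (le_refl t) = id := by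
      funext c
      induction c using SimpleGraph.ConnectedComponent.ind
      rfl
    ext1
    simp only [this, Finsupp.lmapDomain_id]
    rfl
  map_comp {r s t} f g := by
    have : vrComponentMap (id : Z → Z) (fun _ _ => le_rfl) (leOfHom (f ≫ g)) =
        vrComponentMap (id : Z → Z) (fun _ _ => le_rfl) (leOfHom g) ∘
          vrComponentMap (id : Z → Z) (fun _ _ => le_rfl) (leOfHom f) := by
      funext c
      induction c using SimpleGraph.ConnectedComponent.ind
      rfl
    ext1
    simp only [this, Finsupp.lmapDomain_comp]
    rfl

/-- The persistence morphism `PH₀(X) → PH₀(Z)` induced by a non-expansive map. -/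
def PH0map {X Z : Type u} [MetricSpace X] [MetricSpace Z] (φ : X → Z)
    (hφ : ∀ x y, dist (φ x) (φ y) ≤ dist x y) : PH0 X ⟶ PH0 Z where
  app t := ModuleCat.ofHom (Finsupp.lmapDomain (ZMod 2) (ZMod 2)
    (vrComponentMap φ hφ (le_refl t)))
  naturality {s t} h := by
    have : vrComponentMap φ hφ (le_refl t) ∘
          vrComponentMap (id : X → X) (fun _ _ => le_rfl) (leOfHom h) =
        vrComponentMap (id : Z → Z) (fun _ _ => le_rfl) (leOfHom h) ∘
          vrComponentMap φ hφ (le_refl s) := by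
      funext c
      induction c using SimpleGraph.ConnectedComponent.ind
      rfl
    ext1
    simp only [PH0, ModuleCat.hom_comp, ModuleCat.hom_ofHom, ← Finsupp.lmapDomain_comp]
    exact congrArg _ this

end Persistence

end

/-!
Let `E = U₀`. Since `V₀ → V_t` and `U₀ → U_t` are surjective for `t ≥ 0`, both modules are quotients
of their spaces at `0`, and since `f₀` is injective everything can be read off from two increasing
families of subspaces of `E`: the images `f₀(ker(V₀ → V_t))`, completed by `f₀(V₀)`, and the kernels
`ker(U₀ → U_t)`.

Two chains of subspaces of a finite-dimensional space have a common adapted basis: one basis of `E`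
such that each member of either chain is spanned by basis vectors (`exists_basis_adapted`). Each
basis vector `e i` then has a death time `γ i` in the domain (`⊤` if it never dies there, or does not
come from `V₀`) and a death time `β i ≤ γ i` in the codomain. For large `t` the graphs on `X` and `Z`
are connected and `f_t` is injective, so exactly one basis vector `e i₀` survives forever in `U`, and
it comes from `V₀`; the image of `f₀` is spanned by `e i₀` and the `e i` with `γ i < ⊤`. This is the
structure `MatchedBasis`, whose existence is `exists_matchedBasis`.

In such a basis all five modules are visibly sums of interval modules: `V` has the intervals
`[0, γ i)` and `im f` the intervals `[0, β i)` for the `e i` in the image of `f₀`, `U` has all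
`[0, β i)`, `coker f` has `[0, β i)` for the `e i` outside the image, and `ker f` has `[β i, γ i)`.
The block function `M(a, b)` counts the `i` with `(γ i, β i) = (a, b)`, because sums and
intersections of coordinate subspaces are unions and intersections of index sets, and `N(b)` counts
those with `(γ i, β i) = (⊤, b)`.

Uniqueness of barcodes comes from ranks: the rank of `W_s → W_t` is the number of bars containing
`s` and `t`, and the number of bars equal to `[a, b)` is an alternating sum of four such ranks
(`eventually_ncard_bar`).
-/

noncomputable section

namespace Persistence

/-! ### Bases adapted to two chains of subspaces -/

section LinearAlgebra

variable {K E : Type*} [Field K] [AddCommGroup E] [Module K E]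

/-- A nonzero subspace `H` has a hyperplane that contains the trace on `H` of every member of a given
chain whose trace is proper: the largest of these proper traces lies in a hyperplane. -/
theorem exists_hyperplane_of_isChain [FiniteDimensional K E] {𝓕 : Set (Submodule K E)}
    (h𝓕 : IsChain (· ≤ ·) 𝓕) {H : Submodule K E} (hH : H ≠ ⊥) :
    ∃ H', H' ⋖ H ∧ ∀ F ∈ 𝓕, H ≤ F ∨ F ⊓ H ≤ H' := by
  -- The zero subspace is included so that there is a largest trace also if no trace is proper.
  have hne : {P : Submodule K E | P < H ∧ (P = ⊥ ∨ ∃ F ∈ 𝓕, P = F ⊓ H)}.Nonempty :=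
    ⟨⊥, bot_lt_iff_ne_bot.2 hH, Or.inl rfl⟩
  obtain ⟨P, ⟨hPH, hP⟩, hmax⟩ := WellFounded.has_min
    (wellFounded_gt (α := Submodule K E)) _ hne
  obtain ⟨H', hPH', hH'⟩ := exists_le_covBy_of_lt hPH
  refine ⟨H', hH', fun F hF => ?_⟩
  by_contra! hcon
  obtain ⟨h1, h2⟩ := hcon
  have hlt : F ⊓ H < H := lt_of_le_of_ne inf_le_right fun h => h1 (inf_eq_right.1 h)
  have hnot : ¬ P < F ⊓ H := hmax _ ⟨hlt, Or.inr ⟨F, hF, rfl⟩⟩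
  rcases hP with rfl | ⟨F', hF', rfl⟩
  · exact h2 ((not_bot_lt_iff.1 hnot).trans_le bot_le)
  · rcases h𝓕.total hF hF' with h | h
    · exact h2 ((inf_le_inf_right H h).trans hPH')
    · have := (inf_le_inf_right H h).lt_or_eq.resolve_left hnot
      exact h2 (this ▸ hPH')

/-- The traces on `H` of two chains of subspaces have a common adapted basis. By induction, pass to a
hyperplane `H'` of `H` that is compatible with `𝓕`, and enlarge a basis of `H'` by a vector that lies
in the smallest member of `𝓖` whose trace on `H` is not contained in `H'`. -/
theorem exists_linearIndepOn_adapted [FiniteDimensional K E] {𝓕 𝓖 : Set (Submodule K E)}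
    (h𝓕 : IsChain (· ≤ ·) 𝓕) (h𝓖 : IsChain (· ≤ ·) 𝓖) (H : Submodule K E) :
    ∃ B : Set E, LinearIndepOn K id B ∧ Submodule.span K B = H ∧
      (∀ F ∈ 𝓕, Submodule.span K (B ∩ F) = F ⊓ H) ∧
      ∀ G ∈ 𝓖, Submodule.span K (B ∩ G) = G ⊓ H := by
  induction H using WellFoundedLT.induction with
  | ind H ih =>
  by_cases hH : H = ⊥
  · subst hH
    exact ⟨∅, linearIndepOn_empty _ _, by simp, by simp, by simp⟩
  obtain ⟨H', hcov, h𝓕H⟩ := exists_hyperplane_of_isChain h𝓕 hH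
  obtain ⟨B, hB, hspan, hBF, hBG⟩ := ih H' hcov.lt
  obtain ⟨e, heH, heH', heG⟩ : ∃ e ∈ H, e ∉ H' ∧ ∀ G ∈ 𝓖, e ∉ G → G ⊓ H ≤ H' := by
    by_cases hex : ∃ G ∈ 𝓖, ¬ G ⊓ H ≤ H'
    · obtain ⟨G, ⟨hG, hGH⟩, hmin⟩ := WellFounded.has_min
        (wellFounded_lt (α := Submodule K E)) {G | G ∈ 𝓖 ∧ ¬ G ⊓ H ≤ H'} hex
      obtain ⟨e, he, heH'⟩ := SetLike.not_le_iff_exists.1 hGH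
      refine ⟨e, he.2, heH', fun G' hG' heG' => ?_⟩
      by_contra hcon
      rcases h𝓖.total hG hG' with h | h
      · exact heG' (h he.1)
      · rcases h.lt_or_eq with h | h
        · exact hmin G' ⟨hG', hcon⟩ h
        · exact heG' (h ▸ he.1)
    · push Not at hex
      obtain ⟨e, he, heH'⟩ := SetLike.exists_of_lt hcov.lt
      exact ⟨e, he, heH', fun G hG _ => hex G hG⟩
  have hsup : Submodule.span K {e} ⊔ H' = H := by
    have h1 : H' < Submodule.span K {e} ⊔ H' :=
      lt_of_le_of_ne le_sup_right fun h => heH' (h ▸ le_sup_left (α := Submodule K E)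
        (Submodule.mem_span_singleton_self e))
    have h2 : Submodule.span K {e} ⊔ H' ≤ H :=
      sup_le ((Submodule.span_singleton_le_iff_mem _ _).2 heH) hcov.le
    exact h2.lt_or_eq.resolve_left (hcov.2 h1)
  refine ⟨insert e B, hB.id_insert (by rwa [hspan]), by rw [Submodule.span_insert, hspan, hsup],
    fun F hF => ?_, fun G hG => ?_⟩
  · rcases h𝓕H F hF with h | h
    · rw [inf_eq_right.2 h, Set.inter_eq_left.2, Submodule.span_insert, hspan, hsup]
      rw [← Submodule.span_le, Submodule.span_insert, hspan, hsup]
      exact h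
    · have he : e ∉ F := fun he => heH' (h ⟨he, heH⟩)
      rw [Set.insert_inter_of_notMem (by exact he), hBF F hF]
      exact le_antisymm (inf_le_inf_left _ hcov.le) (le_inf inf_le_left h)
  · by_cases he : e ∈ G
    · rw [Set.insert_inter_of_mem (by exact he), Submodule.span_insert, hBG G hG, ← hsup,
        inf_comm G H', inf_comm G, sup_inf_assoc_of_le _
          ((Submodule.span_singleton_le_iff_mem _ _).2 he)]
    · rw [Set.insert_inter_of_notMem (by exact he), hBG G hG]
      exact le_antisymm (inf_le_inf_left _ hcov.le) (le_inf inf_le_left (heG G hG he))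

theorem exists_basis_adapted [FiniteDimensional K E] {𝓕 𝓖 : Set (Submodule K E)}
    (h𝓕 : IsChain (· ≤ ·) 𝓕) (h𝓖 : IsChain (· ≤ ·) 𝓖) :
    ∃ (n : ℕ) (e : Module.Basis (Fin n) K E), ∀ F ∈ 𝓕 ∪ 𝓖,
      Submodule.span K (e '' {i | e i ∈ F}) = F := by
  obtain ⟨B, hB, hspan, hBF, hBG⟩ := exists_linearIndepOn_adapted h𝓕 h𝓖 ⊤
  have hfin : Finite B := hB.linearIndependent.finite
  let b : Module.Basis B K E := Module.Basis.mk hB.linearIndependent (by simp [hspan])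
  refine ⟨Nat.card B, b.reindex (Finite.equivFin B), fun F hF => ?_⟩
  have hb : ∀ i : B, b i = i := fun i => by simp [b]
  have : (b.reindex (Finite.equivFin B)) '' {i | b.reindex (Finite.equivFin B) i ∈ F} =
      B ∩ F := by
    ext x
    constructor
    · rintro ⟨i, hi, rfl⟩
      refine ⟨?_, hi⟩
      rw [Module.Basis.reindex_apply, hb]
      exact Subtype.prop _
    · rintro ⟨hx, hxF⟩
      have hx' : b.reindex (Finite.equivFin B) (Finite.equivFin B ⟨x, hx⟩) = x := by
        rw [Module.Basis.reindex_apply, Equiv.symm_apply_apply, hb]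
      exact ⟨Finite.equivFin B ⟨x, hx⟩, by rwa [Set.mem_ofPred_eq, hx'], hx'⟩
  rw [this]
  rcases hF with hF | hF
  · simpa using hBF F hF
  · simpa using hBG F hF

variable {ι : Type*} (e : Module.Basis ι K E)

/-- The coordinate subspace of a basis that belongs to a set of indices. -/
def coordSpan (T : Set ι) : Submodule K E := Submodule.span K (e '' T)

theorem mem_coordSpan {T : Set ι} {x : E} : x ∈ coordSpan e T ↔ ∀ i, e.repr x i ≠ 0 → i ∈ T := by
  rw [coordSpan, e.mem_span_image]
  simp [Set.subset_def]

theorem basis_mem_coordSpan {T : Set ι} {i : ι} : e i ∈ coordSpan e T ↔ i ∈ T := by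
  rw [mem_coordSpan]
  refine ⟨fun h => h i (by simp), fun h j hj => ?_⟩
  rw [e.repr_self, Finsupp.single_apply_ne_zero] at hj
  exact hj.1 ▸ h

theorem coordSpan_inf (S T : Set ι) : coordSpan e S ⊓ coordSpan e T = coordSpan e (S ∩ T) := by
  ext x
  simp only [Submodule.mem_inf, mem_coordSpan, Set.mem_inter_iff]
  grind

theorem coordSpan_sup (S T : Set ι) : coordSpan e S ⊔ coordSpan e T = coordSpan e (S ∪ T) := by
  rw [coordSpan, coordSpan, coordSpan, Set.image_union, Submodule.span_union]

theorem coordSpan_mono {S T : Set ι} (h : S ⊆ T) : coordSpan e S ≤ coordSpan e T :=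
  Submodule.span_mono (Set.image_mono h)

/-- If the kernel of a map is a coordinate subspace, then the remaining basis vectors have
independent images. -/
theorem linearIndepOn_comp_basis {F : Type*} [AddCommGroup F] [Module K F] (g : E →ₗ[K] F)
    {T : Set ι} (hg : LinearMap.ker g = coordSpan e T) :
    LinearIndepOn K (fun i => g (e i)) Tᶜ := by
  have h : LinearIndepOn K e Tᶜ := e.linearIndependent.linearIndepOn _
  refine LinearIndependent.map h ?_
  rw [hg, ← Set.image_eq_range]
  change Disjoint (coordSpan e Tᶜ) _
  rw [disjoint_iff, coordSpan_inf]
  simp [coordSpan]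

theorem finrank_coordSpan [Finite ι] (T : Set ι) :
    Module.finrank K (coordSpan e T) = Nat.card T := by
  classical
  have := Fintype.ofFinite ι
  have h : LinearIndependent K fun i : T => e i := e.linearIndependent.comp _ Subtype.val_injective
  rw [coordSpan, Set.image_eq_range, finrank_span_eq_card h, Nat.card_eq_fintype_card]

theorem finrank_quotient_coordSpan [Finite ι] {S T : Set ι} (h : T ⊆ S) :
    Module.finrank K (↥(coordSpan e S) ⧸ (coordSpan e T).submoduleOf (coordSpan e S)) =
      Nat.card ↥(S \ T) := by
  have hfin : FiniteDimensional K E := e.finiteDimensional_of_finite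
  have h1 := Submodule.finrank_quotient_add_finrank
    ((coordSpan e T).submoduleOf (coordSpan e S))
  rw [(Submodule.submoduleOfEquivOfLe (coordSpan_mono e h)).finrank_eq, finrank_coordSpan,
    finrank_coordSpan] at h1
  have h2 : Nat.card ↥(S \ T) + Nat.card T = Nat.card S :=
    Set.ncard_sdiff_add_ncard_of_subset h
  omega

end LinearAlgebra

/-! ### Interval bases -/

/-- A decomposition of `W` into interval modules, given by generators: a family of elements
`elem t i` of `W_t`, zero for `t ∉ I i`, compatible with the structure maps that start inside `I i`,
such that for each `t` the elements with `t ∈ I i` form a basis of `W_t`. -/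
structure IntervalBasis (W : PersistenceModule.{u}) {ι : Type} (I : ι → Set ℝ) where
  elem : ∀ t : ℝ, ι → W.obj t
  elem_eq_zero : ∀ {t i}, t ∉ I i → elem t i = 0
  map_elem : ∀ {s t i} (h : s ≤ t), s ∈ I i → structureMap W h (elem s i) = elem t i
  indep : ∀ t, LinearIndepOn (ZMod 2) (elem t) {i | t ∈ I i}
  span : ∀ t, Submodule.span (ZMod 2) (Set.range (elem t)) = ⊤

namespace IntervalBasis

variable {W W' : PersistenceModule.{u}} {ι κ : Type} {I : ι → Set ℝ}

theorem span_image (e : IntervalBasis W I) (t : ℝ) :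
    Submodule.span (ZMod 2) (e.elem t '' {i | t ∈ I i}) = ⊤ := by
  rw [eq_top_iff, ← e.span t, Submodule.span_le]
  rintro _ ⟨i, rfl⟩
  by_cases h : t ∈ I i
  · exact Submodule.subset_span ⟨i, h, rfl⟩
  · rw [e.elem_eq_zero h]
    exact Submodule.zero_mem _

/-- The basis of `W_t` given by the generators that are alive at `t`. -/
def basis (e : IntervalBasis W I) (t : ℝ) :
    Module.Basis {i | t ∈ I i} (ZMod 2) (W.obj t) :=
  Module.Basis.mk (e.indep t) (by rw [← Set.image_eq_range, e.span_image])

theorem basis_apply (e : IntervalBasis W I) (t : ℝ) (i) : e.basis t i = e.elem t i :=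
  Module.Basis.mk_apply _ _ i

/-- Modules that have interval bases with the same family of intervals are isomorphic. -/
def iso (e : IntervalBasis W I) (e' : IntervalBasis W' I) : W ≅ W' :=
  NatIso.ofComponents
    (fun t => ((e.basis t).equiv (e'.basis t) (Equiv.refl _)).toModuleIso) (by
    intro s t h
    have key : ∀ (t : ℝ) (i : ι),
        (e.basis t).equiv (e'.basis t) (Equiv.refl _) (e.elem t i) = e'.elem t i := by
      intro t i
      by_cases hi : t ∈ I i
      · rw [← e.basis_apply t ⟨i, hi⟩, Module.Basis.equiv_apply, e'.basis_apply]
        rfl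
      · rw [e.elem_eq_zero hi, e'.elem_eq_zero hi, map_zero]
    refine ModuleCat.hom_ext ((e.basis s).ext fun i => ?_)
    have h1 := e.map_elem (leOfHom h) i.2
    have h2 := e'.map_elem (leOfHom h) i.2
    have h3 : (e.basis s) i = e.elem s i := e.basis_apply s i
    simp only [ModuleCat.hom_comp, LinearMap.comp_apply, h3]
    change (e.basis t).equiv (e'.basis t) (Equiv.refl _) (structureMap W (leOfHom h) _) =
      structureMap W' (leOfHom h) ((e.basis s).equiv (e'.basis s) (Equiv.refl _) _)
    rw [h1, key, key, h2])

/-- The image of an interval basis under an isomorphism. -/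
def ofIso (e : IntervalBasis W I) (f : W ≅ W') : IntervalBasis W' I where
  elem t i := (f.app t).toLinearEquiv (e.elem t i)
  elem_eq_zero h := by rw [e.elem_eq_zero h, map_zero]
  map_elem h hs := by
    rw [← e.map_elem h hs]
    exact (naturality_apply f.hom (homOfLE h) _).symm
  indep t := LinearIndependent.map' (e.indep t) (f.app t).toLinearEquiv.toLinearMap
    (LinearEquiv.ker _)
  span t := by
    have := congrArg (Submodule.map (f.app t).toLinearEquiv.toLinearMap) (e.span t)
    rw [Submodule.map_span, ← Set.range_comp, Submodule.map_top, LinearEquiv.range] at this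
    exact this

/-- Reindexing along an injective map that misses only empty intervals. -/
def reindex (e : IntervalBasis W I) (g : κ → ι) (hg : Function.Injective g)
    (hI : ∀ i, (I i).Nonempty → i ∈ Set.range g) : IntervalBasis W fun k => I (g k) where
  elem t k := e.elem t (g k)
  elem_eq_zero h := e.elem_eq_zero h
  map_elem h hs := e.map_elem h hs
  indep t := (e.indep t).comp (fun k : {k | t ∈ I (g k)} => (⟨g k, k.2⟩ : {i | t ∈ I i}))
    fun k k' h => Subtype.ext (hg (congrArg Subtype.val h))
  span t := by
    rw [eq_top_iff, ← e.span_image t]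
    refine Submodule.span_mono ?_
    rintro _ ⟨i, hi, rfl⟩
    obtain ⟨k, rfl⟩ := hI i ⟨t, hi⟩
    exact ⟨k, rfl⟩

open Classical in
/-- The generator at `t` of the interval module of `S` (zero if `t ∉ S`). -/
def intervalGen (S : Set ℝ) (t : ℝ) : intervalSpace.{u} S t :=
  ⟨if t ∈ S then 1 else 0, fun h => if_neg h⟩

theorem intervalGen_eq_zero {S : Set ℝ} {t : ℝ} (h : t ∉ S) : intervalGen.{u} S t = 0 :=
  Subtype.ext (if_neg h)

theorem smul_intervalGen {S : Set ℝ} {t : ℝ} (x : intervalSpace.{u} S t) :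
    x.1.down • intervalGen.{u} S t = x := by
  refine Subtype.ext ?_
  by_cases h : t ∈ S
  · ext
    simp [intervalGen, h]
  · simp [intervalGen, h, x.2 h]

theorem intervalMap_intervalGen {S : Set ℝ} {s : ℝ} (t : ℝ) (h : s ∈ S) :
    intervalMap.{u} S s t (intervalGen S s) = intervalGen S t := by
  simp [intervalMap, intervalGen, h]

theorem smul_intervalGen_eq_zero {S : Set ℝ} {t : ℝ} (h : t ∈ S) {c : ZMod 2}
    (hc : c • intervalGen.{u} S t = 0) : c = 0 := by
  have := congrArg (fun x => x.1.down) hc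
  simpa [intervalGen, h] using this

/-- The interval basis of an interval module, with one generator. -/
def intervalModule (S : Set ℝ) [S.OrdConnected] :
    IntervalBasis (intervalModule.{u} S) fun _ : Unit => S where
  elem t _ := intervalGen S t
  elem_eq_zero h := intervalGen_eq_zero h
  map_elem {s t _} _ hs := intervalMap_intervalGen t hs
  indep t := by
    refine linearIndependent_iff'.2 fun s c hc i hi => ?_
    have : s = {i} := by
      ext j
      simp only [Finset.mem_singleton, Subsingleton.elim j i, hi]
    rw [this, Finset.sum_singleton] at hc
    exact smul_intervalGen_eq_zero i.2 hc
  span t := by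
    rw [eq_top_iff]
    intro x _
    rw [← smul_intervalGen.{u} (S := S) x]
    exact Submodule.smul_mem _ _ (Submodule.subset_span ⟨(), rfl⟩)

/-- The interval basis of a direct sum of interval modules. -/
def directSum (I : ι → Set ℝ) [∀ i, (I i).OrdConnected] :
    IntervalBasis (directSum fun i => Persistence.intervalModule.{u} (I i)) I := by
  classical
  exact
  { elem := fun t i => DirectSum.lof (ZMod 2) ι (fun i => intervalSpace.{u} (I i) t) i
      (intervalGen (I i) t)
    elem_eq_zero := fun h => by
      rw [intervalGen_eq_zero h, map_zero]
      rfl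
    map_elem := fun {s t i} h hs => by
      refine (DirectSum.lmap_lof (fun i => intervalMap.{u} (I i) s t) _ _).trans ?_
      rw [intervalMap_intervalGen t hs]
    indep := fun t => by
      refine linearIndependent_iff'.2 fun s c hc i hi => ?_
      change ∑ i ∈ s, c i • DirectSum.lof (ZMod 2) ι (fun i => intervalSpace.{u} (I i) t) i.1
        (intervalGen (I i) t) = 0 at hc
      have h1 := congrArg (DirectSum.component (ZMod 2) ι
        (fun i => intervalSpace.{u} (I i) t) i.1) hc
      rw [map_sum, Finset.sum_eq_single i, map_smul, map_zero, DirectSum.component.lof_self] at h1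
      · exact smul_intervalGen_eq_zero i.2 h1
      · intro j _ hj
        rw [map_smul, DirectSum.component.of, dif_neg, smul_zero]
        exact fun h => hj (Subtype.ext h)
      · exact fun h => (h hi).elim
    span := fun t => by
      rw [eq_top_iff]
      rintro x -
      change DirectSum ι (fun i => intervalSpace.{u} (I i) t) at x
      induction x using DirectSum.induction_on with
      | zero => exact Submodule.zero_mem _
      | of i x =>
        rw [← smul_intervalGen.{u} x]
        have : DirectSum.of (fun i => intervalSpace.{u} (I i) t) i
            (x.1.down • intervalGen (I i) t) = x.1.down • DirectSum.lof (ZMod 2) ι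
              (fun i => intervalSpace.{u} (I i) t) i (intervalGen (I i) t) := by
          rw [← map_smul]
          rfl
        rw [this]
        exact Submodule.smul_mem _ _ (Submodule.subset_span ⟨i, rfl⟩)
      | add x y hx hy => exact Submodule.add_mem _ hx hy }

/-- The disjoint union of interval bases of `W` and `W'`, as an interval basis of `W ⊕ W'`. -/
def directSumTwo {J : κ → Set ℝ} (e : IntervalBasis W I) (e' : IntervalBasis W' J) :
    IntervalBasis (directSumTwo W W') (Sum.elim I J) where
  elem t := Sum.elim (LinearMap.inl (ZMod 2) (W.obj t) (W'.obj t) ∘ e.elem t)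
    (LinearMap.inr (ZMod 2) (W.obj t) (W'.obj t) ∘ e'.elem t)
  elem_eq_zero {t i} h := by
    rcases i with i | i
    · exact Prod.ext (e.elem_eq_zero h) rfl
    · exact Prod.ext rfl (e'.elem_eq_zero h)
  map_elem {s t i} h hs := by
    rcases i with i | i
    · exact Prod.ext (e.map_elem h hs) (map_zero (structureMap W' h))
    · exact Prod.ext (map_zero (structureMap W h)) (e'.map_elem h hs)
  indep t := by
    have h := linearIndependent_inl_union_inr' (e.indep t) (e'.indep t)
    let g : {i | t ∈ (Sum.elim I J) i} → {i | t ∈ I i} ⊕ {i | t ∈ J i} := fun i =>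
      match i with
      | ⟨Sum.inl i, hi⟩ => Sum.inl ⟨i, hi⟩
      | ⟨Sum.inr i, hi⟩ => Sum.inr ⟨i, hi⟩
    have hg : Function.Injective g := by
      rintro ⟨i | i, hi⟩ ⟨j | j, hj⟩ hij
      · exact Subtype.ext (congrArg Sum.inl (congrArg Subtype.val (Sum.inl.inj hij)))
      · cases hij
      · cases hij
      · exact Subtype.ext (congrArg Sum.inr (congrArg Subtype.val (Sum.inr.inj hij)))
    have hcomp := h.comp g hg
    have heq : Sum.elim (LinearMap.inl (ZMod 2) (W.obj t) (W'.obj t) ∘ fun i : {i | t ∈ I i} =>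
          e.elem t i) (LinearMap.inr (ZMod 2) (W.obj t) (W'.obj t) ∘ fun i : {i | t ∈ J i} =>
          e'.elem t i) ∘ g =
        fun i : {i | t ∈ (Sum.elim I J) i} =>
          Sum.elim (LinearMap.inl (ZMod 2) (W.obj t) (W'.obj t) ∘ e.elem t)
            (LinearMap.inr (ZMod 2) (W.obj t) (W'.obj t) ∘ e'.elem t) i.1 := by
      funext i
      rcases i with ⟨i | i, hi⟩ <;> rfl
    rw [heq] at hcomp
    exact hcomp
  span t := by
    change Submodule.span (ZMod 2) (Set.range (Sum.elim
      (LinearMap.inl (ZMod 2) (W.obj t) (W'.obj t) ∘ e.elem t)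
      (LinearMap.inr (ZMod 2) (W.obj t) (W'.obj t) ∘ e'.elem t))) = ⊤
    rw [Set.Sum.elim_range, Submodule.span_union, Set.range_comp, Set.range_comp,
      ← Submodule.map_span, ← Submodule.map_span, e.span, e'.span, Submodule.map_top,
      Submodule.map_top]
    exact LinearMap.sup_range_inl_inr

end IntervalBasis

/-! ### Counting bars by ranks -/

/-- The interval `[l, r)`, where `r` may be infinite. It is empty if `r ≤ l`. -/
def bar (l : ℝ) (r : WithTop ℝ) : Set ℝ := {t | l ≤ t ∧ (t : WithTop ℝ) < r}

theorem mem_bar {l t : ℝ} {r : WithTop ℝ} : t ∈ bar l r ↔ l ≤ t ∧ (t : WithTop ℝ) < r := Iff.rfl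

theorem bar_coe (a b : ℝ) : bar a b = Set.Ico a b := by
  ext t
  simp [mem_bar]

theorem bar_top (a : ℝ) : bar a ⊤ = Set.Ici a := by
  ext t
  simp [mem_bar]

namespace IntervalBasis

variable {W : PersistenceModule.{u}} {ι κ : Type} {I : ι → Set ℝ}

theorem finite_setOf_mem (e : IntervalBasis W I) {t : ℝ} [Module.Finite (ZMod 2) (W.obj t)] :
    {i | t ∈ I i}.Finite :=
  (e.indep t).linearIndependent.finite

theorem module_finite [Finite ι] (e : IntervalBasis W I) (t : ℝ) :
    Module.Finite (ZMod 2) (W.obj t) :=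
  Module.Finite.of_basis (e.basis t)

/-- The rank of `W_s → W_t` is the number of bars that contain `s` and `t`. -/
theorem finrank_range (e : IntervalBasis W I) {s t : ℝ} (h : s ≤ t) :
    Module.finrank (ZMod 2) (LinearMap.range (structureMap W h)) =
      {i | s ∈ I i ∧ t ∈ I i}.ncard := by
  have hind : LinearIndepOn (ZMod 2) (e.elem t) {i | s ∈ I i ∧ t ∈ I i} :=
    (e.indep t).mono fun i hi => hi.2
  have hrange : LinearMap.range (structureMap W h) =
      Submodule.span (ZMod 2) (Set.range fun i : {i | s ∈ I i ∧ t ∈ I i} => e.elem t i) := by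
    rw [LinearMap.range_eq_map, ← e.span_image s, Submodule.map_span]
    apply le_antisymm
    · rw [Submodule.span_le]
      rintro _ ⟨_, ⟨i, hi, rfl⟩, rfl⟩
      rw [e.map_elem h hi]
      by_cases hi' : t ∈ I i
      · exact Submodule.subset_span ⟨⟨i, hi, hi'⟩, rfl⟩
      · rw [e.elem_eq_zero hi']
        exact Submodule.zero_mem _
    · refine Submodule.span_mono ?_
      rintro _ ⟨⟨i, hi⟩, rfl⟩
      exact ⟨_, ⟨i, hi.1, rfl⟩, e.map_elem h hi.1⟩
  rw [hrange, Module.finrank_eq_nat_card_basis (Module.Basis.span hind.linearIndependent)]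
  rfl

end IntervalBasis

open Filter Topology in
/-- The number of bars equal to `[a, b)` is determined by the numbers of bars through pairs of points,
where `a'` and `b'` are slightly smaller than `a` and `b`. Only the finitely many bars through `a`
matter, so that `a'` can be taken above all left endpoints `< a` of these, and `b'` above all right
endpoints `< b`. -/
theorem eventually_ncard_bar {ι : Type} {l : ι → ℝ} {r : ι → WithTop ℝ} {a b : ℝ} (hab : a < b)
    (hfin : {i | a ∈ bar (l i) (r i)}.Finite) :
    ∀ᶠ a' in 𝓝[<] a, ∀ᶠ b' in 𝓝[<] b,
      {i | l i = a ∧ r i = b}.ncard +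
        ({i | a ∈ bar (l i) (r i) ∧ b ∈ bar (l i) (r i)}.ncard +
          {i | a' ∈ bar (l i) (r i) ∧ b' ∈ bar (l i) (r i)}.ncard) =
      {i | a ∈ bar (l i) (r i) ∧ b' ∈ bar (l i) (r i)}.ncard +
        {i | a' ∈ bar (l i) (r i) ∧ b ∈ bar (l i) (r i)}.ncard := by
  have h1 : ∀ᶠ a' in 𝓝[<] a, ∀ i ∈ {i | a ∈ bar (l i) (r i)}, l i < a → l i < a' := by
    refine (eventually_all_finite hfin).2 fun i _ => ?_
    by_cases hi : l i < a
    · filter_upwards [Ioo_mem_nhdsLT hi] with a' ha' _ using ha'.1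
    · exact Eventually.of_forall fun _ h => (hi h).elim
  have h2 : ∀ᶠ b' : ℝ in 𝓝[<] b, ∀ i ∈ {i | a ∈ bar (l i) (r i)},
      r i < (b : WithTop ℝ) → r i < (b' : WithTop ℝ) := by
    refine (eventually_all_finite hfin).2 fun i _ => ?_
    by_cases hi : r i < (b : WithTop ℝ)
    · obtain ⟨c, hc⟩ := WithTop.ne_top_iff_exists.1 (ne_top_of_lt hi)
      rw [← hc, WithTop.coe_lt_coe] at hi
      filter_upwards [Ioo_mem_nhdsLT hi] with b' hb' _
      rw [← hc, WithTop.coe_lt_coe]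
      exact hb'.1
    · exact Eventually.of_forall fun _ h => (hi h).elim
  filter_upwards [h1, self_mem_nhdsWithin] with a' ha' haa'
  filter_upwards [h2, Ioo_mem_nhdsLT hab] with b' hb' hbb'
  set A := {i | a ∈ bar (l i) (r i) ∧ b' ∈ bar (l i) (r i)} with hA
  set B := {i | a ∈ bar (l i) (r i) ∧ b ∈ bar (l i) (r i)} with hB
  set C := {i | a' ∈ bar (l i) (r i) ∧ b' ∈ bar (l i) (r i)} with hC
  have hlt : ∀ {x y : ℝ} {z : WithTop ℝ}, x < y → (y : WithTop ℝ) < z → (x : WithTop ℝ) < z :=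
    fun h h' => (WithTop.coe_lt_coe.2 h).trans h'
  have hAfin : A.Finite := hfin.subset fun i hi => hi.1
  have hBA : B ⊆ A := fun i hi =>
    ⟨hi.1, hi.1.1.trans hbb'.1.le, hlt hbb'.2 hi.2.2⟩
  have hCA : C ⊆ A := fun i hi =>
    ⟨⟨hi.1.1.trans (le_of_lt haa'), hlt hbb'.1 hi.2.2⟩, hi.2⟩
  have hBC : B ∩ C = {i | a' ∈ bar (l i) (r i) ∧ b ∈ bar (l i) (r i)} := by
    ext i
    exact ⟨fun h => ⟨h.2.1, h.1.2⟩, fun h =>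
      have haA : a ∈ bar (l i) (r i) := ⟨h.1.1.trans (le_of_lt haa'), hlt hab h.2.2⟩
      ⟨⟨haA, h.2⟩, h.1, haA.1.trans hbb'.1.le, hlt hbb'.2 h.2.2⟩⟩
  have hdiff : {i | l i = a ∧ r i = b} = A \ (B ∪ C) := by
    ext i
    constructor
    · rintro ⟨rfl, hr⟩
      refine ⟨⟨⟨le_rfl, ?_⟩, hbb'.1.le, ?_⟩, ?_⟩
      · rw [hr]; exact WithTop.coe_lt_coe.2 hab
      · rw [hr]; exact WithTop.coe_lt_coe.2 hbb'.2
      · rintro (h | h)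
        · exact absurd h.2.2 (by rw [hr]; exact lt_irrefl _)
        · exact absurd h.1.1 (not_le.2 haa')
    · rintro ⟨hiA, hi⟩
      have h3 : l i = a := by
        refine le_antisymm hiA.1.1 (le_of_not_gt fun h => hi (Or.inr ?_))
        have h4 := ha' i hiA.1 h
        exact ⟨⟨h4.le, hlt haa' hiA.1.2⟩, hiA.2⟩
      refine ⟨h3, le_antisymm (le_of_not_gt fun h => hi (Or.inl ?_)) (le_of_not_gt fun h => ?_)⟩
      · exact ⟨hiA.1, h3.le.trans hab.le, h⟩
      · exact absurd (hb' i hiA.1 h) (not_lt.2 hiA.2.2.le)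
  have e1 := Set.ncard_sdiff_add_ncard_of_subset (Set.union_subset hBA hCA) hAfin
  have e2 := Set.ncard_union_add_ncard_inter B C (hAfin.subset hBA) (hAfin.subset hCA)
  rw [← hdiff] at e1
  rw [hBC] at e2
  omega

/-- The multiplicity of a bounded bar is the same in any two decompositions, the second of which may
be infinite. -/
theorem ncard_bar_unique {W : PersistenceModule.{u}} {ι κ : Type} [Finite ι]
    {l : ι → ℝ} {r : ι → WithTop ℝ} {l' : κ → ℝ} {r' : κ → WithTop ℝ}
    (e : IntervalBasis W fun i => bar (l i) (r i))
    (e' : IntervalBasis W fun i => bar (l' i) (r' i)) {a b : ℝ} (hab : a < b) :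
    {i | l i = a ∧ r i = b}.ncard = {i | l' i = a ∧ r' i = b}.ncard := by
  have := e.module_finite a
  obtain ⟨a', h, ha'⟩ := ((eventually_ncard_bar hab (Set.toFinite {i | a ∈ bar (l i) (r i)})).and
    ((eventually_ncard_bar hab e'.finite_setOf_mem).and self_mem_nhdsWithin)).exists
  obtain ⟨b', h, h', hb'⟩ := (h.and (ha'.1.and (Ioo_mem_nhdsLT hab))).exists
  have key : ∀ {s t : ℝ} (_ : s ≤ t), {i | s ∈ bar (l i) (r i) ∧ t ∈ bar (l i) (r i)}.ncard =
      {i | s ∈ bar (l' i) (r' i) ∧ t ∈ bar (l' i) (r' i)}.ncard := fun hst => by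
    rw [← e.finrank_range hst, ← e'.finrank_range hst]
  have haa' : a' < a := ha'.2
  rw [key hab.le, key (haa'.le.trans hb'.1.le), key hb'.1.le, key (haa'.trans hab).le] at h
  omega

/-! ### Interval bases and barcodes -/

/-- An enumeration of the fibers of a relation: `x = (t, n)` is sent to the `n`-th index `i` with
`R t i`. -/
def enumFibers {ι T : Type*} [Finite ι] (R : T → ι → Prop) {m : T → ℕ}
    (hm : ∀ t, m t = {i | R t i}.ncard) (x : Σ t, Fin (m t)) : {i // R x.1 i} :=
  (Finite.equivFin {i | R x.1 i}).symm (finCongr (hm x.1) x.2)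

theorem enumFibers_injective {ι T : Type*} [Finite ι] {R : T → ι → Prop} {m : T → ℕ}
    (hm : ∀ t, m t = {i | R t i}.ncard) (hR : ∀ {t t' i}, R t i → R t' i → t = t') :
    Function.Injective fun x => (enumFibers R hm x).1 := by
  rintro ⟨t, n⟩ ⟨t', n'⟩ h
  have hn := (enumFibers R hm ⟨t, n⟩).2
  obtain rfl : t = t' := hR hn (by
    have := (enumFibers R hm ⟨t', n'⟩).2
    rwa [← show (enumFibers R hm ⟨t, n⟩).1 = (enumFibers R hm ⟨t', n'⟩).1 from h] at this)
  have := (finCongr (hm t)).injective ((Finite.equivFin {i | R t i}).symm.injective (Subtype.ext h))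
  rw [show n = n' from this]

theorem exists_enumFibers_eq {ι T : Type*} [Finite ι] {R : T → ι → Prop} {m : T → ℕ}
    (hm : ∀ t, m t = {i | R t i}.ncard) {t : T} {i : ι} (h : R t i) :
    ∃ x, (enumFibers R hm x).1 = i :=
  ⟨⟨t, finCongr (hm t).symm (Finite.equivFin {i | R t i} ⟨i, h⟩)⟩,
    congrArg Subtype.val ((Finite.equivFin {i | R t i}).symm_apply_apply ⟨i, h⟩)⟩

theorem ncard_enum {T : Type} (m : T → ℕ) (t : T) :
    {x : Σ t, Fin (m t) | x.1 = t}.ncard = m t := by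
  have : {x : Σ t, Fin (m t) | x.1 = t} =
      Set.range fun n : Fin (m t) => (⟨t, n⟩ : Σ t, Fin (m t)) := by
    ext ⟨t', n⟩
    constructor
    · rintro rfl
      exact ⟨n, rfl⟩
    · rintro ⟨n', h⟩
      exact (congrArg Sigma.fst h).symm
  rw [this]
  exact (Set.ncard_range_of_injective sigma_mk_injective).trans (Nat.card_fin _)

/-- The interval basis of a direct sum of modules `κ_{[a,b)}` and copies of `κ_∞`. -/
def IntervalBasis.directSumBars {ι : Type} (κ : Type) (a b : ι → ℝ) :
    IntervalBasis (Persistence.directSumTwo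
        (Persistence.directSum fun i => kappaIco.{u} (a i) (b i))
        (Persistence.directSum fun _ : κ => kappaInfty.{u}))
      (Sum.elim (fun i => Set.Ico (a i) (b i)) fun _ : κ => Set.Ici 0) :=
  (IntervalBasis.directSum fun i => Set.Ico (a i) (b i)).directSumTwo
    (IntervalBasis.directSum fun _ : κ => Set.Ici (0 : ℝ))

/-- An interval basis, with the intervals replaced by equal ones. -/
def IntervalBasis.congr {W : PersistenceModule.{u}} {ι : Type} {I J : ι → Set ℝ}
    (e : IntervalBasis W I) (h : ∀ i, I i = J i) : IntervalBasis W J :=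
  (funext h : I = J) ▸ e

theorem hasIntervalDecomposition_of_intervalBasis {W : PersistenceModule.{u}} {ι : Type}
    [Finite ι] {l : ι → ℝ} {r : ι → WithTop ℝ} (e : IntervalBasis W fun i => bar (l i) (r i))
    (htop : ∀ i, r i = ⊤ → l i = 0) :
    HasIntervalDecomposition W fun J => {i | l i = J.left ∧ r i = J.right}.ncard := by
  let R : BarInterval → ι → Prop := fun J i => l i = J.left ∧ r i = J.right
  let R' : Unit → ι → Prop := fun _ i => r i = ⊤
  let k : ℕ := {i | r i = ⊤}.ncard
  have hR : ∀ {t t' i}, R t i → R t' i → t = t' := by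
    rintro ⟨a, b, h⟩ ⟨a', b', h'⟩ i ⟨h1, h2⟩ ⟨h3, h4⟩
    obtain rfl : a = a' := h1.symm.trans h3
    obtain rfl : b = b' := WithTop.coe_injective (h2.symm.trans h4)
    rfl
  let g1 := fun x => (enumFibers R (fun _ => rfl) x).1
  let g2 := fun n : Fin k => (enumFibers R' (m := fun _ => k) (fun _ => rfl) ⟨(), n⟩).1
  have hg1 : ∀ x, R x.1 (g1 x) := fun x => (enumFibers R (fun _ => rfl) x).2
  have hg2 : ∀ n, r (g2 n) = ⊤ := fun n => (enumFibers R' (fun _ => rfl) ⟨(), n⟩).2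
  have hinj : Function.Injective (Sum.elim g1 g2) := by
    refine (enumFibers_injective (R := R) (fun _ => rfl) hR).sumElim (fun n n' h => ?_) fun x n h => ?_
    · have := enumFibers_injective (R := R') (m := fun _ => k) (fun _ => rfl) (fun _ _ => rfl) h
      simpa using this
    · have h1 := (hg1 x).2
      rw [show g1 x = g2 n from h, hg2] at h1
      exact WithTop.top_ne_coe h1
  -- Indices with an empty bar are dropped: they are not hit by `g1` or `g2`.
  have e1 := e.reindex (Sum.elim g1 g2) hinj (by
    rintro i ⟨t, ht⟩
    by_cases hi : r i = ⊤
    · obtain ⟨⟨_, n⟩, hn⟩ := exists_enumFibers_eq (R := R') (m := fun _ => k) (fun _ => rfl)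
        (t := ()) hi
      exact ⟨Sum.inr n, hn⟩
    · obtain ⟨b, hb⟩ := WithTop.ne_top_iff_exists.1 hi
      have hlt : l i < b := WithTop.coe_lt_coe.1
        ((WithTop.coe_le_coe.2 ht.1).trans_lt (hb ▸ ht.2))
      obtain ⟨x, hx⟩ := exists_enumFibers_eq (R := R) (fun _ => rfl) (t := ⟨l i, b, hlt⟩)
        (i := i) ⟨rfl, hb.symm⟩
      exact ⟨Sum.inl x, hx⟩)
  refine ⟨k, ⟨(e1.congr ?_).iso (IntervalBasis.directSumBars _ _ _)⟩⟩
  rintro (x | n)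
  · have := hg1 x
    rw [Sum.elim_inl, Sum.elim_inl, this.1, this.2, bar_coe]
  · rw [Sum.elim_inr, Sum.elim_inr, hg2, htop _ (hg2 n), bar_top]

/-- A finite interval basis with infinite bars only of the form `[0, ∞)` determines the barcode.
Empty bars do no harm, as they are not counted. -/
theorem isBarcode_of_intervalBasis {W : PersistenceModule.{u}} {ι : Type}
    [Finite ι] {l : ι → ℝ} {r : ι → WithTop ℝ} (e : IntervalBasis W fun i => bar (l i) (r i))
    (htop : ∀ i, r i = ⊤ → l i = 0) :
    IsBarcode W fun J => {i | l i = J.left ∧ r i = J.right}.ncard := by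
  refine ⟨hasIntervalDecomposition_of_intervalBasis e htop, ?_⟩
  rintro m ⟨k, ⟨f⟩⟩
  let l' : (Σ J : BarInterval, Fin (m J)) ⊕ Fin k → ℝ := Sum.elim (fun x => x.1.left) fun _ => 0
  let r' : (Σ J : BarInterval, Fin (m J)) ⊕ Fin k → WithTop ℝ :=
    Sum.elim (fun x => (x.1.right : WithTop ℝ)) fun _ => ⊤
  have e' : IntervalBasis W fun i => bar (l' i) (r' i) :=
    ((IntervalBasis.directSumBars _ _ _).ofIso f.symm).congr (by
      rintro (x | n)
      · exact (bar_coe _ _).symm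
      · exact (bar_top _).symm)
  funext J
  rw [ncard_bar_unique e e' J.lt, ← ncard_enum m J]
  have : {i | l' i = J.left ∧ r' i = J.right} = Sum.inl '' {x | x.1 = J} := by
    ext (⟨⟨a, b, h⟩, n⟩ | n)
    · obtain ⟨a', b', h'⟩ := J
      simp [l', r']
    · simp [r']
  rw [this, Set.ncard_image_of_injective _ Sum.inl_injective]

theorem IsBarcode.barcode_eq {W : PersistenceModule.{u}} {m : BarInterval → ℕ}
    (h : IsBarcode W m) : barcode W = m := by
  have hex : ∃ m, IsBarcode W m := ⟨m, h⟩
  rw [barcode, dif_pos hex]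
  exact h.2 _ hex.choose_spec.1

theorem finsum_ncard_fiber {ι T : Type*} [Finite ι] (R : T → ι → Prop)
    (hR : ∀ {t t' i}, R t i → R t' i → t = t') (p : T → Prop) :
    ∑ᶠ (t : T) (_ : p t), {i | R t i}.ncard = {i | ∃ t, p t ∧ R t i}.ncard := by
  have hfin : {t | p t ∧ ∃ i, R t i}.Finite := by
    choose g hg using fun i : {i // ∃ t, R t i} => i.2
    refine (Set.finite_range g).subset ?_
    rintro t ⟨-, i, hi⟩
    exact ⟨⟨i, t, hi⟩, hR (hg _) hi⟩
  classical
  have := Fintype.ofFinite ι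
  have hcard : ∀ P : ι → Prop, {i | P i}.ncard = (Finset.univ.filter P).card := fun P => by
    rw [← Set.ncard_coe_finset]
    congr 1
    ext i
    simp
  have hsum := finsum_mem_eq_sum_of_inter_support_eq (fun t => {i | R t i}.ncard)
    (s := {t | p t}) (t := hfin.toFinset) (by
      ext t
      simp only [Set.mem_inter_iff, Set.mem_ofPred_eq, Set.Finite.coe_toFinset,
        Function.mem_support]
      refine ⟨fun h => ⟨⟨h.1, ?_⟩, h.2⟩, fun h => ⟨h.1.1, h.2⟩⟩
      by_contra hcon
      refine h.2 ?_
      rw [Set.ncard_eq_zero]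
      exact Set.eq_empty_of_forall_notMem fun i hi => hcon ⟨i, hi⟩)
  refine hsum.trans ?_
  simp only [hcard]
  rw [← Finset.card_biUnion]
  · congr 1
    ext i
    simp only [Finset.mem_biUnion, Set.Finite.mem_toFinset, Set.mem_ofPred_eq, Finset.mem_filter,
      Finset.mem_univ, true_and]
    exact ⟨fun ⟨t, h, h'⟩ => ⟨t, h.1, h'⟩, fun ⟨t, h, h'⟩ => ⟨t, ⟨h, i, h'⟩, h'⟩⟩
  · intro t _ t' _ htt'
    refine Finset.disjoint_left.2 ?_
    intro i hi hi'
    exact htt' (hR (Finset.mem_filter.1 hi).2 (Finset.mem_filter.1 hi').2)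

/-! ### Modules generated at zero -/

/-- `W` vanishes at negative times and all maps `W_0 → W_t`, `t ≥ 0`, are surjective. -/
structure GeneratedAtZero (W : PersistenceModule.{u}) : Prop where
  subsingleton_of_neg : ∀ {t : ℝ}, t < 0 → Subsingleton (W.obj t)
  surjective : ∀ {t : ℝ} (h : 0 ≤ t), Function.Surjective (structureMap W h)

theorem structureMap_comp_apply (W : PersistenceModule.{u}) {r s t : ℝ} (h : r ≤ s) (h' : s ≤ t)
    (x : W.obj r) : structureMap W h' (structureMap W h x) = structureMap W (h.trans h') x := by
  have := congrArg (fun g => g.hom x) (W.map_comp (homOfLE h) (homOfLE h'))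
  exact this.symm

theorem structureMap_refl_apply (W : PersistenceModule.{u}) {t : ℝ} (x : W.obj t) :
    structureMap W le_rfl x = x := by
  have := congrArg (fun g => g.hom x) (W.map_id t)
  exact this

theorem structureMap_naturality {V U : PersistenceModule.{u}} (f : V ⟶ U) {s t : ℝ} (h : s ≤ t)
    (x : V.obj s) :
    (f.app t).hom (structureMap V h x) = structureMap U h ((f.app s).hom x) :=
  naturality_apply f (homOfLE h) x

open Classical in
/-- Let `W` be generated at zero. If the kernels of the maps `E → W_0 → W_t` are spanned by the vectors
of a basis of `E` with `r i ≤ t`, then `W` has an interval basis with the bars `[0, r i)`. -/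
def IntervalBasis.ofZero {W : PersistenceModule.{u}} (hW : GeneratedAtZero W) {ι : Type}
    {E : Type*} [AddCommGroup E] [Module (ZMod 2) E] (b : Module.Basis ι (ZMod 2) E)
    (g : E →ₗ[ZMod 2] W.obj 0) (hg : Function.Surjective g) (r : ι → WithTop ℝ)
    (hker : ∀ t (h : 0 ≤ t),
      LinearMap.ker (structureMap W h ∘ₗ g) = coordSpan b {i | r i ≤ (t : WithTop ℝ)}) :
    IntervalBasis W fun i => bar 0 (r i) where
  elem t i := if h : 0 ≤ t then structureMap W h (g (b i)) else 0
  elem_eq_zero {t i} hi := by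
    split_ifs with h
    · have : b i ∈ LinearMap.ker (structureMap W h ∘ₗ g) := by
        rw [hker t h, basis_mem_coordSpan]
        exact not_lt.1 fun h' => hi ⟨h, h'⟩
      exact this
    · rfl
  map_elem {s t i} h hs := by
    rw [dif_pos hs.1, dif_pos (hs.1.trans h), structureMap_comp_apply]
  indep t := by
    by_cases h : 0 ≤ t
    · simp only [dif_pos h]
      refine (linearIndepOn_comp_basis b _ (hker t h)).mono fun i hi => ?_
      exact not_le.2 hi.2
    · convert linearIndepOn_empty (ZMod 2) _
      exact Set.eq_empty_of_forall_notMem fun i hi => h hi.1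
  span t := by
    by_cases h : 0 ≤ t
    · simp only [dif_pos h]
      have := congrArg (Submodule.map (structureMap W h ∘ₗ g)) b.span_eq
      rw [Submodule.map_span, Submodule.map_top, ← Set.range_comp,
        LinearMap.range_eq_top.2 (by
          rw [LinearMap.coe_comp]
          exact (hW.surjective h).comp hg)] at this
      exact this
    · have := hW.subsingleton_of_neg (not_le.1 h)
      exact Subsingleton.elim _ _

variable {V U : PersistenceModule.{u}}

theorem generatedAtZero_imModule (hV : GeneratedAtZero V) (hU : GeneratedAtZero U) (f : V ⟶ U) :
    GeneratedAtZero (imModule f) where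
  subsingleton_of_neg {t} h := by
    have := hU.subsingleton_of_neg h
    exact inferInstanceAs (Subsingleton (LinearMap.range (f.app t).hom))
  surjective {t} h := by
    rintro ⟨_, y, rfl⟩
    obtain ⟨x, rfl⟩ := hV.surjective h y
    exact ⟨⟨_, x, rfl⟩, Subtype.ext (structureMap_naturality f h x).symm⟩

theorem generatedAtZero_cokerModule (hU : GeneratedAtZero U) (f : V ⟶ U) :
    GeneratedAtZero (cokerModule f) where
  subsingleton_of_neg {t} h := by
    have := hU.subsingleton_of_neg h
    exact inferInstanceAs (Subsingleton (U.obj t ⧸ LinearMap.range (f.app t).hom))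
  surjective {t} h := by
    intro y
    obtain ⟨y, rfl⟩ := Submodule.Quotient.mk_surjective _ y
    obtain ⟨x, rfl⟩ := hU.surjective h y
    exact ⟨Submodule.Quotient.mk x, rfl⟩

theorem range_app (hV : GeneratedAtZero V) (f : V ⟶ U) (t : ℝ) (h : 0 ≤ t) :
     LinearMap.range (f.app t).hom =
    (LinearMap.range (f.app 0).hom).map (structureMap U h) := by
  ext y
  constructor
  · rintro ⟨x, rfl⟩
    obtain ⟨x, rfl⟩ := hV.surjective h x
    exact ⟨_, ⟨x, rfl⟩, (structureMap_naturality f h x).symm⟩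
  · rintro ⟨_, ⟨x, rfl⟩, rfl⟩
    exact ⟨_, structureMap_naturality f h x⟩

/-! ### Matched bases and the induced interval bases -/

/-- A basis of `U_0` adapted to the filtrations by `f₀(ker(V_0 → V_t))` and by `ker(U_0 → U_t)`, and to
the image of `f₀`. A basis vector dies in the domain at `domDeath i`, which is `⊤` if it never dies
there or does not lie in the image of `f₀`, and in the codomain at `codDeath i`. Exactly one basis
vector, `essential`, never dies in the codomain, and the image of `f₀` is spanned by it and the basis
vectors that die in the domain. -/
structure MatchedBasis (f : V ⟶ U) (ι : Type) where
  domGenerated : GeneratedAtZero V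
  codGenerated : GeneratedAtZero U
  injective : Function.Injective (f.app 0).hom
  basis : Module.Basis ι (ZMod 2) (U.obj 0)
  domDeath : ι → WithTop ℝ
  codDeath : ι → WithTop ℝ
  essential : ι
  codDeath_le : ∀ i, codDeath i ≤ domDeath i
  codDeath_pos : ∀ i, 0 < codDeath i
  codDeath_eq_top : ∀ i, codDeath i = ⊤ ↔ i = essential
  map_ker : ∀ (t : ℝ) (h : 0 ≤ t), (LinearMap.ker (structureMap V h)).map (f.app 0).hom =
    coordSpan basis {i | domDeath i ≤ (t : WithTop ℝ)}
  ker : ∀ (t : ℝ) (h : 0 ≤ t), LinearMap.ker (structureMap U h) =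
    coordSpan basis {i | codDeath i ≤ (t : WithTop ℝ)}
  range : LinearMap.range (f.app 0).hom = coordSpan basis {i | domDeath i ≠ ⊤ ∨ i = essential}

namespace MatchedBasis

variable {f : V ⟶ U} {ι : Type} (B : MatchedBasis f ι)

theorem domDeath_pos (i : ι) : 0 < B.domDeath i := (B.codDeath_pos i).trans_le (B.codDeath_le i)

/-- The indices of the basis vectors in the image of `f₀`. -/
abbrev DomIndex : Type := {i : ι // B.domDeath i ≠ ⊤ ∨ i = B.essential}

theorem exists_domLift (i : B.DomIndex) : ∃ x : V.obj 0, (f.app 0).hom x = B.basis i := by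
  have : B.basis i ∈ LinearMap.range (f.app 0).hom := by
    rw [B.range, basis_mem_coordSpan]
    exact i.2
  exact this

/-- The preimage in `V_0` of a basis vector in the image of `f₀`. -/
def domLift (i : B.DomIndex) : V.obj 0 := (B.exists_domLift i).choose

theorem app_domLift (i : B.DomIndex) : (f.app 0).hom (B.domLift i) = B.basis i :=
  (B.exists_domLift i).choose_spec

/-- The basis of `V_0` formed by the preimages of the basis vectors in the image of `f₀`. -/
def domBasis : Module.Basis B.DomIndex (ZMod 2) (V.obj 0) :=
  Module.Basis.mk (v := B.domLift)
    (by
      refine LinearIndependent.of_comp (f.app 0).hom ?_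
      convert B.basis.linearIndependent.comp (fun i : B.DomIndex => i.1) Subtype.val_injective
      exact funext B.app_domLift)
    (by
      rw [← Submodule.map_le_map_iff_of_injective B.injective, Submodule.map_top, B.range,
        Submodule.map_span, ← Set.range_comp, coordSpan]
      refine Submodule.span_mono ?_
      rintro _ ⟨i, hi, rfl⟩
      exact ⟨⟨i, hi⟩, B.app_domLift ⟨i, hi⟩⟩)

theorem app_domBasis (i : B.DomIndex) : (f.app 0).hom (B.domBasis i) = B.basis i := by
  rw [domBasis, Module.Basis.mk_apply, app_domLift]

theorem map_coordSpan_domBasis (S : Set B.DomIndex) :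
    (coordSpan B.domBasis S).map (f.app 0).hom = coordSpan B.basis (Subtype.val '' S) := by
  rw [coordSpan, coordSpan, Submodule.map_span, Set.image_image, Set.image_image]
  simp only [B.app_domBasis]

theorem ker_dom (t : ℝ) (h : 0 ≤ t) : LinearMap.ker (structureMap V h) =
    coordSpan B.domBasis {i | B.domDeath i ≤ (t : WithTop ℝ)} := by
  apply Submodule.map_injective_of_injective B.injective
  rw [map_coordSpan_domBasis, B.map_ker]
  congr 1
  ext i
  exact ⟨fun hi => ⟨⟨i, Or.inl (ne_top_of_le_ne_top (WithTop.coe_ne_top) hi)⟩, hi, rfl⟩,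
    by rintro ⟨i, hi, rfl⟩; exact hi⟩

theorem ker_comp (t : ℝ) (h : 0 ≤ t) : LinearMap.ker (structureMap U h ∘ₗ (f.app 0).hom) =
    coordSpan B.domBasis {i | B.codDeath i ≤ (t : WithTop ℝ)} := by
  apply Submodule.map_injective_of_injective B.injective
  rw [map_coordSpan_domBasis, LinearMap.ker_comp, Submodule.map_comap_eq, B.ker, B.range,
    coordSpan_inf]
  congr 1
  ext i
  exact ⟨fun hi => ⟨⟨i, hi.1⟩, hi.2, rfl⟩, by rintro ⟨i, hi, rfl⟩; exact ⟨i.2, hi⟩⟩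

/-- The domain has the bars `[0, domDeath i)`, for the indices of the image of `f₀`. -/
def domIntervals : IntervalBasis V fun i : B.DomIndex => bar 0 (B.domDeath i) :=
  .ofZero B.domGenerated B.domBasis LinearMap.id Function.surjective_id _ fun t h => by
    rw [LinearMap.comp_id, B.ker_dom]

/-- The codomain has the bars `[0, codDeath i)`. -/
def codIntervals : IntervalBasis U fun i => bar 0 (B.codDeath i) :=
  .ofZero B.codGenerated B.basis LinearMap.id Function.surjective_id _ fun t h => by
    rw [LinearMap.comp_id, B.ker]

/-- The image has the bars `[0, codDeath i)`, for the indices of the image of `f₀`. -/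
def imIntervals : IntervalBasis (imModule f) fun i : B.DomIndex => bar 0 (B.codDeath i) :=
  .ofZero (generatedAtZero_imModule B.domGenerated B.codGenerated f) B.domBasis
    (f.app 0).hom.rangeRestrict (LinearMap.surjective_rangeRestrict _) _ fun t h => by
      rw [← B.ker_comp t h]
      ext x
      exact Subtype.ext_iff

open Classical in
/-- The death time of a basis vector in the cokernel; basis vectors in the image of `f₀` die at once,
so that their bars `[0, 0)` are empty. -/
def cokerDeath (i : ι) : WithTop ℝ :=
  if B.domDeath i ≠ ⊤ ∨ i = B.essential then 0 else B.codDeath i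

/-- The cokernel has the bars `[0, cokerDeath i)`. -/
def cokerIntervals : IntervalBasis (cokerModule f) fun i => bar 0 (B.cokerDeath i) :=
  .ofZero (generatedAtZero_cokerModule B.codGenerated f) B.basis
    (Submodule.mkQ (LinearMap.range (f.app 0).hom)) (Submodule.mkQ_surjective _) _ fun t h => by
      have : structureMap (cokerModule f) h ∘ₗ Submodule.mkQ (LinearMap.range (f.app 0).hom) =
        Submodule.mkQ (LinearMap.range (f.app t).hom) ∘ₗ structureMap U h := rfl
      rw [this]
      change LinearMap.ker (Submodule.mkQ (LinearMap.range (f.app t).hom) ∘ₗ structureMap U h) = _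
      rw [LinearMap.ker_comp, Submodule.ker_mkQ, range_app B.domGenerated f t h, Submodule.comap_map_eq,
        B.ker, B.range, coordSpan_sup]
      congr 1
      ext i
      by_cases hi : B.domDeath i ≠ ⊤ ∨ i = B.essential
      · exact iff_of_true (Or.inl hi)
          ((if_pos hi).trans_le (WithTop.coe_le_coe.2 h) : B.cokerDeath i ≤ (t : WithTop ℝ))
      · have : B.cokerDeath i = B.codDeath i := if_neg hi
        simp only [Set.mem_union, Set.mem_ofPred_eq, hi, false_or, this]

theorem mem_ker_app_structureMap (t : ℝ) (h : 0 ≤ t) (x : V.obj 0) :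
    structureMap V h x ∈ LinearMap.ker (f.app t).hom ↔
      x ∈ coordSpan B.domBasis {i | B.codDeath i ≤ (t : WithTop ℝ)} := by
  rw [← B.ker_comp t h, LinearMap.mem_ker, LinearMap.mem_ker, structureMap_naturality]
  rfl

open Classical in
/-- The element of `ker f_t` given by a basis vector of `V_0`, from the time at which it dies in the
codomain. -/
def kerElem (t : ℝ) (i : B.DomIndex) : LinearMap.ker (f.app t).hom :=
  if h : 0 ≤ t ∧ B.codDeath i ≤ (t : WithTop ℝ) then
    ⟨structureMap V h.1 (B.domBasis i), (B.mem_ker_app_structureMap t h.1 _).2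
      ((basis_mem_coordSpan _).2 h.2)⟩ else 0

theorem coe_kerElem {t : ℝ} {i : B.DomIndex} (h : 0 ≤ t) (hi : B.codDeath i ≤ (t : WithTop ℝ)) :
    (B.kerElem t i : V.obj t) = structureMap V h (B.domBasis i) := by
  rw [kerElem, dif_pos ⟨h, hi⟩]

/-- The kernel has the bars `[codDeath i, domDeath i)`, for the indices of the image of `f₀`. -/
def kerIntervals : IntervalBasis (kerModule f) fun i : B.DomIndex =>
    {t : ℝ | B.codDeath i ≤ (t : WithTop ℝ) ∧ (t : WithTop ℝ) < B.domDeath i} where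
  elem := B.kerElem
  elem_eq_zero {t i} hi := by
    by_cases h : 0 ≤ t ∧ B.codDeath i ≤ (t : WithTop ℝ)
    · refine Subtype.ext ((B.coe_kerElem h.1 h.2).trans ?_)
      have : B.domBasis i ∈ LinearMap.ker (structureMap V h.1) := by
        rw [B.ker_dom, basis_mem_coordSpan]
        exact not_lt.1 fun h' => hi ⟨h.2, h'⟩
      exact this
    · exact dif_neg h
  map_elem {s t i} h hs := by
    have hs0 : 0 ≤ s := WithTop.coe_le_coe.1 ((B.codDeath_pos i).le.trans hs.1)
    refine Subtype.ext (Eq.trans ?_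
      (B.coe_kerElem (hs0.trans h) (hs.1.trans (WithTop.coe_le_coe.2 h))).symm)
    rw [← structureMap_comp_apply V hs0 h, ← B.coe_kerElem hs0 hs.1]
    rfl
  indep t := by
    by_cases h : 0 ≤ t
    · refine LinearIndependent.of_comp (LinearMap.ker (f.app t).hom).subtype ?_
      have := (linearIndepOn_comp_basis B.domBasis _ (B.ker_dom t h)).mono
        (t := {i : B.DomIndex |
          B.codDeath i ≤ (t : WithTop ℝ) ∧ (t : WithTop ℝ) < B.domDeath i})
        fun i hi => not_le.2 hi.2
      have heq := (linearIndepOn_congr (R := ZMod 2)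
        (w := fun i => (B.kerElem t i : V.obj t)) fun i hi => (B.coe_kerElem h hi.1).symm).1 this
      exact heq
    · rw [Set.eq_empty_of_forall_notMem (s := {i : B.DomIndex | t ∈ {t : ℝ |
        B.codDeath i ≤ (t : WithTop ℝ) ∧ (t : WithTop ℝ) < B.domDeath i}}) fun i hi => h ?_]
      · exact linearIndepOn_empty _ _
      exact WithTop.coe_le_coe.1 ((B.codDeath_pos i).le.trans hi.1)
  span t := by
    change Submodule.span (ZMod 2) (Set.range (B.kerElem t)) = ⊤
    by_cases h : 0 ≤ t
    · apply Submodule.map_injective_of_injective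
        (LinearMap.ker (f.app t).hom).injective_subtype
      rw [Submodule.map_subtype_top, Submodule.map_span]
      apply le_antisymm
      · rw [Submodule.span_le]
        rintro _ ⟨x, -, rfl⟩
        exact x.2
      · intro y hy
        obtain ⟨x, rfl⟩ := B.domGenerated.surjective h y
        have := Submodule.mem_map_of_mem (f := structureMap V h)
          ((B.mem_ker_app_structureMap t h x).1 hy)
        rw [coordSpan, Submodule.map_span] at this
        refine Submodule.span_mono ?_ this
        rintro _ ⟨_, ⟨i, hi, rfl⟩, rfl⟩
        exact ⟨_, ⟨i, rfl⟩, B.coe_kerElem h hi⟩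
    · have := B.domGenerated.subsingleton_of_neg (not_le.1 h)
      exact Subsingleton.elim _ _

/-! ### The block function and the barcodes in a matched basis -/

theorem kerPlus_cod (b : ℝ) :
    kerPlus U b = coordSpan B.basis {i | B.codDeath i ≤ (b : WithTop ℝ)} := by
  by_cases h : 0 ≤ b
  · rw [kerPlus, dif_pos h, B.ker]
  · rw [kerPlus, dif_neg h, Set.eq_empty_of_forall_notMem
      (s := {i | B.codDeath i ≤ (b : WithTop ℝ)})]
    · simp [coordSpan]
    · exact fun i hi => h (WithTop.coe_le_coe.1 ((B.codDeath_pos i).le.trans hi))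

theorem map_kerPlus_dom (a : ℝ) : (kerPlus V a).map (f.app 0).hom =
    coordSpan B.basis {i | B.domDeath i ≤ (a : WithTop ℝ)} := by
  by_cases h : 0 ≤ a
  · rw [kerPlus, dif_pos h, B.map_ker]
  · rw [kerPlus, dif_neg h, Set.eq_empty_of_forall_notMem
      (s := {i | B.domDeath i ≤ (a : WithTop ℝ)})]
    · simp [coordSpan]
    · exact fun i hi => h (WithTop.coe_le_coe.1 ((B.domDeath_pos i).le.trans hi))

theorem iSup_coordSpan_le (d : ι → WithTop ℝ) (hd : ∀ i, 0 < d i) (b : ℝ) :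
    ⨆ (r : ℝ) (_ : 0 ≤ r) (_ : r < b), coordSpan B.basis {i | d i ≤ (r : WithTop ℝ)} =
      coordSpan B.basis {i | d i < (b : WithTop ℝ)} := by
  apply le_antisymm
  · refine iSup_le fun r => iSup_le fun _ => iSup_le fun hr => coordSpan_mono _ fun i hi => ?_
    exact lt_of_le_of_lt hi (WithTop.coe_lt_coe.2 hr)
  · rw [coordSpan, Submodule.span_le]
    rintro _ ⟨i, hi, rfl⟩
    have hi' : d i < (b : WithTop ℝ) := hi
    obtain ⟨r, hr⟩ := WithTop.ne_top_iff_exists.1 hi'.ne_top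
    refine Submodule.mem_iSup_of_mem r (Submodule.mem_iSup_of_mem ?_
      (Submodule.mem_iSup_of_mem ?_ ((basis_mem_coordSpan _).2 hr.ge)))
    · exact WithTop.coe_le_coe.1 ((hd i).le.trans hr.ge)
    · exact WithTop.coe_lt_coe.1 (hr.trans_lt hi)

theorem kerMinus_cod (b : ℝ) :
    kerMinus U b = coordSpan B.basis {i | B.codDeath i < (b : WithTop ℝ)} := by
  rw [← B.iSup_coordSpan_le _ B.codDeath_pos, kerMinus]
  exact iSup_congr fun r => iSup_congr fun hr => iSup_congr fun _ => B.ker r hr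

theorem map_kerMinus_dom (a : ℝ) : (kerMinus V a).map (f.app 0).hom =
    coordSpan B.basis {i | B.domDeath i < (a : WithTop ℝ)} := by
  rw [← B.iSup_coordSpan_le _ B.domDeath_pos, kerMinus]
  exact (Submodule.map_iSup _ _).trans (iSup_congr fun r =>
    (Submodule.map_iSup _ _).trans (iSup_congr fun hr =>
      (Submodule.map_iSup _ _).trans (iSup_congr fun _ => B.map_ker r hr)))

/-- The number of basis vectors that die at `a` in the domain and at `b` in the codomain. -/
def count (a : WithTop ℝ) (b : ℝ) : ℕ := {i | B.domDeath i = a ∧ B.codDeath i = b}.ncard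

theorem ncard_domIndex (q : ι → Prop) : {i : B.DomIndex | q i}.ncard =
    {i | (B.domDeath i ≠ ⊤ ∨ i = B.essential) ∧ q i}.ncard := by
  rw [← Set.ncard_image_of_injective _ Subtype.val_injective]
  congr 1
  ext i
  exact ⟨by rintro ⟨i, hi, rfl⟩; exact ⟨i.2, hi⟩, fun h => ⟨⟨i, h.1⟩, h.2, rfl⟩⟩

theorem not_essential_of_codDeath_eq {i : ι} {b : ℝ} (h : B.codDeath i = b) : i ≠ B.essential :=
  fun hi => WithTop.coe_ne_top (h.symm.trans ((B.codDeath_eq_top i).2 hi))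

theorem codDeath_ne_top {i : ι} (h : B.domDeath i ≠ ⊤) : B.codDeath i ≠ ⊤ :=
  ne_top_of_le_ne_top h (B.codDeath_le i)

theorem cokerDeath_eq_iff {i : ι} {b : ℝ} (hb : 0 < b) :
    B.cokerDeath i = b ↔ B.domDeath i = ⊤ ∧ B.codDeath i = b := by
  by_cases hi : B.domDeath i ≠ ⊤ ∨ i = B.essential
  · rw [cokerDeath, if_pos hi]
    refine iff_of_false (fun h => hb.ne (WithTop.coe_injective h)) ?_
    rintro ⟨h1, h2⟩
    exact hi.elim (fun h => h h1) (B.not_essential_of_codDeath_eq h2)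
  · rw [cokerDeath, if_neg hi]
    exact ⟨fun h => ⟨not_not.1 fun h' => hi (Or.inl h'), h⟩, And.right⟩

variable [Finite ι]

theorem blockFunction_eq (a b : ℝ) : blockFunction (f.app 0).hom a b = B.count a b := by
  have h1 : (kerPlus V a).map (f.app 0).hom ⊓ kerPlus U b = coordSpan B.basis
      ({i | B.domDeath i ≤ (a : WithTop ℝ)} ∩ {i | B.codDeath i ≤ (b : WithTop ℝ)}) := by
    rw [B.map_kerPlus_dom, B.kerPlus_cod, coordSpan_inf]
  have h2 : (kerMinus V a).map (f.app 0).hom ⊓ kerPlus U b = coordSpan B.basis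
      ({i | B.domDeath i < (a : WithTop ℝ)} ∩ {i | B.codDeath i ≤ (b : WithTop ℝ)}) := by
    rw [B.map_kerMinus_dom, B.kerPlus_cod, coordSpan_inf]
  have h3 : (kerPlus V a).map (f.app 0).hom ⊓ kerMinus U b = coordSpan B.basis
      ({i | B.domDeath i ≤ (a : WithTop ℝ)} ∩ {i | B.codDeath i < (b : WithTop ℝ)}) := by
    rw [B.map_kerPlus_dom, B.kerMinus_cod, coordSpan_inf]
  rw [blockFunction, h1, h2, h3, coordSpan_sup, finrank_quotient_coordSpan, count]
  · change Set.ncard _ = _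
    congr 1
    ext i
    simp only [Set.mem_sdiff, Set.mem_inter_iff, Set.mem_union, Set.mem_ofPred_eq]
    constructor
    · rintro ⟨⟨h1, h2⟩, h3⟩
      exact ⟨h1.eq_of_not_lt fun h => h3 (Or.inl ⟨h, h2⟩),
        h2.eq_of_not_lt fun h => h3 (Or.inr ⟨h1, h⟩)⟩
    · rintro ⟨h1, h2⟩
      simp [h1, h2]
  · rintro i (h | h)
    · exact ⟨le_of_lt (show B.domDeath i < a from h.1), h.2⟩
    · exact ⟨h.1, le_of_lt (show B.codDeath i < b from h.2)⟩

theorem isBarcode_cod : IsBarcode U fun J =>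
    {i | (0 : ℝ) = J.left ∧ B.codDeath i = J.right}.ncard :=
  isBarcode_of_intervalBasis B.codIntervals fun _ _ => rfl

theorem finsum_count (b : ℝ) (p : WithTop ℝ → Prop) :
    ∑ᶠ (a : WithTop ℝ) (_ : p a), B.count a b =
      {i | p (B.domDeath i) ∧ B.codDeath i = b}.ncard := by
  refine (finsum_ncard_fiber (fun a i => B.domDeath i = a ∧ B.codDeath i = b)
    (fun h h' => h.1.symm.trans h'.1) p).trans ?_
  congr 1
  ext i
  exact ⟨fun ⟨a, ha, h, h'⟩ => ⟨h ▸ ha, h'⟩, fun ⟨h, h'⟩ => ⟨_, h, rfl, h'⟩⟩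

theorem finsum_coe_count (b : ℝ) (p : ℝ → Prop) :
    ∑ᶠ (a : ℝ) (_ : p a), B.count a b =
      {i | (∃ a : ℝ, p a ∧ B.domDeath i = a) ∧ B.codDeath i = b}.ncard := by
  refine (finsum_ncard_fiber (fun (a : ℝ) i => B.domDeath i = a ∧ B.codDeath i = b)
    (fun h h' => WithTop.coe_injective (h.1.symm.trans h'.1)) p).trans ?_
  congr 1
  ext i
  exact ⟨fun ⟨a, ha, h, h'⟩ => ⟨⟨a, ha, h⟩, h'⟩, fun ⟨⟨a, h, h''⟩, h'⟩ => ⟨a, h, h'', h'⟩⟩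

theorem finsum_count_right (a : ℝ) (p : ℝ → Prop) :
    ∑ᶠ (b : ℝ) (_ : p b), B.count a b =
      {i | B.domDeath i = a ∧ ∃ b : ℝ, p b ∧ B.codDeath i = b}.ncard := by
  refine (finsum_ncard_fiber (fun b i => B.domDeath i = a ∧ B.codDeath i = (b : ℝ))
    (fun h h' => WithTop.coe_injective (h.2.symm.trans h'.2)) p).trans ?_
  congr 1
  ext i
  exact ⟨fun ⟨b, hb, h, h'⟩ => ⟨h, b, hb, h'⟩, fun ⟨h, b, hb, h'⟩ => ⟨b, hb, h, h'⟩⟩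

/-- The bars of the codomain that die at `b` are split by the death time in the domain. -/
theorem ncard_eq_add_count_top {b : ℝ} : {i | B.codDeath i = b}.ncard =
    ∑ᶠ (a : ℝ) (_ : 0 < a), B.count a b + B.count ⊤ b := by
  rw [B.finsum_coe_count, count, ← Set.ncard_union_eq]
  · congr 1
    ext i
    simp only [Set.mem_union, Set.mem_ofPred_eq, ← or_and_right]
    refine ⟨fun h => ⟨?_, h⟩, And.right⟩
    by_cases hi : B.domDeath i = ⊤
    · exact Or.inr hi
    · obtain ⟨a, ha⟩ := WithTop.ne_top_iff_exists.1 hi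
      exact Or.inl ⟨a, WithTop.coe_lt_coe.1 (ha ▸ B.domDeath_pos i), ha.symm⟩
  · rw [Set.disjoint_left]
    rintro i ⟨⟨a, -, h⟩, -⟩ ⟨h', -⟩
    exact WithTop.coe_ne_top (h.symm.trans h')

theorem barcode_cod {b : ℝ} (hb : 0 < b) :
    barcode U ⟨0, b, hb⟩ = {i | B.codDeath i = b}.ncard := by
  rw [B.isBarcode_cod.barcode_eq]
  simp

theorem count_eq_zero {a : WithTop ℝ} {b : ℝ} (hb : ¬ 0 < b) : B.count a b = 0 := by
  rw [count, Set.ncard_eq_zero]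
  refine Set.eq_empty_of_forall_notMem fun i hi => hb ?_
  exact WithTop.coe_lt_coe.1 ((B.codDeath_pos i).trans_eq hi.2)

theorem unmatched_eq (b : ℝ) : unmatched (f.app 0).hom b = B.count ⊤ b := by
  by_cases hb : 0 < b
  · rw [unmatched, dif_pos hb, B.barcode_cod hb, B.ncard_eq_add_count_top]
    simp only [B.blockFunction_eq]
    omega
  · rw [unmatched, dif_neg hb, B.count_eq_zero hb]

theorem matchingDiagram_eq (a : WithTop ℝ) (b : ℝ) :
    matchingDiagram (f.app 0).hom a b = B.count a b := by
  induction a using WithTop.recTopCoe with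
  | top => exact B.unmatched_eq b
  | coe a => exact B.blockFunction_eq a b

theorem finite_support_count : {p : WithTop ℝ × ℝ | B.count p.1 p.2 ≠ 0}.Finite := by
  refine (Set.finite_range fun i => (B.domDeath i, (B.codDeath i).untopD 0)).subset ?_
  rintro ⟨a, b⟩ h
  obtain ⟨i, h1, h2⟩ := Set.nonempty_of_ncard_ne_zero h
  refine ⟨i, ?_⟩
  simp only at h1 h2
  simp [h1, h2]

theorem isBarcode_dom : IsBarcode V fun J => if J.left = 0 then
    ∑ᶠ (b : ℝ) (_ : b ≤ J.right), B.count (J.right : WithTop ℝ) b else 0 := by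
  convert isBarcode_of_intervalBasis B.domIntervals fun _ _ => rfl using 2 with J
  split_ifs with h
  · rw [B.finsum_count_right, B.ncard_domIndex fun i => 0 = J.left ∧ B.domDeath i = J.right]
    congr 1
    ext i
    simp only [Set.mem_ofPred_eq]
    constructor
    · rintro ⟨h1, -⟩
      exact ⟨Or.inl (h1 ▸ WithTop.coe_ne_top), h.symm, h1⟩
    · rintro ⟨-, -, h1⟩
      obtain ⟨b, hb⟩ := WithTop.ne_top_iff_exists.1
        (B.codDeath_ne_top (i := i) (h1 ▸ WithTop.coe_ne_top))
      exact ⟨h1, b, WithTop.coe_le_coe.1 (hb.trans_le ((B.codDeath_le i).trans_eq h1)), hb.symm⟩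
  · symm
    rw [Set.ncard_eq_zero]
    exact Set.eq_empty_of_forall_notMem fun i hi => h hi.1.symm

theorem isBarcode_cod_count : IsBarcode U fun J => if J.left = 0 then
    ∑ᶠ (a : WithTop ℝ) (_ : (J.right : WithTop ℝ) ≤ a), B.count a J.right else 0 := by
  convert B.isBarcode_cod using 2 with J
  split_ifs with h
  · rw [B.finsum_count]
    congr 1
    ext i
    exact ⟨fun hi => ⟨h.symm, hi.2⟩, fun hi => ⟨hi.2.symm.trans_le (B.codDeath_le i), hi.2⟩⟩
  · symm
    rw [Set.ncard_eq_zero]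
    exact Set.eq_empty_of_forall_notMem fun i hi => h hi.1.symm

theorem isBarcode_im : IsBarcode (imModule f) fun J => if J.left = 0 then
    ∑ᶠ (a : ℝ) (_ : J.right ≤ a), B.count (a : WithTop ℝ) J.right else 0 := by
  convert isBarcode_of_intervalBasis B.imIntervals fun _ _ => rfl using 2 with J
  split_ifs with h
  · rw [B.finsum_coe_count, B.ncard_domIndex fun i => 0 = J.left ∧ B.codDeath i = J.right]
    congr 1
    ext i
    simp only [Set.mem_ofPred_eq]
    constructor
    · rintro ⟨⟨a, -, h1⟩, h2⟩
      exact ⟨Or.inl (h1 ▸ WithTop.coe_ne_top), h.symm, h2⟩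
    · rintro ⟨h1, -, h2⟩
      obtain ⟨a, ha⟩ := WithTop.ne_top_iff_exists.1
        (h1.resolve_right (B.not_essential_of_codDeath_eq h2))
      exact ⟨⟨a, WithTop.coe_le_coe.1 ((h2.symm.trans_le (B.codDeath_le i)).trans_eq ha.symm),
        ha.symm⟩, h2⟩
  · symm
    rw [Set.ncard_eq_zero]
    exact Set.eq_empty_of_forall_notMem fun i hi => h hi.1.symm

theorem isBarcode_coker : IsBarcode (cokerModule f) fun J =>
    if J.left = 0 then B.count ⊤ J.right else 0 := by
  convert isBarcode_of_intervalBasis B.cokerIntervals fun _ _ => rfl using 2 with J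
  split_ifs with h
  · rw [count]
    congr 1
    ext i
    simp only [Set.mem_ofPred_eq, B.cokerDeath_eq_iff (h ▸ J.lt), h, true_and]
  · symm
    rw [Set.ncard_eq_zero]
    exact Set.eq_empty_of_forall_notMem fun i hi => h hi.1.symm

/-- The interval basis of the kernel without the essential index, whose bar is empty. The default
value `0` of `untopD` does not occur, since `codDeath i ≤ domDeath i < ⊤`. -/
def kerBars : IntervalBasis (kerModule f) fun i : {i // B.domDeath i ≠ ⊤} =>
    bar ((B.codDeath i).untopD 0) (B.domDeath i) :=
  (B.kerIntervals.reindex (fun i : {i // B.domDeath i ≠ ⊤} => ⟨i, Or.inl i.2⟩)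
    (fun i j h => Subtype.ext (congrArg (fun x : B.DomIndex => x.1) h)) (by
      rintro ⟨i, hi⟩ ⟨t, ht⟩
      refine ⟨⟨i, fun h => ?_⟩, rfl⟩
      obtain rfl := hi.resolve_left (not_not.2 h)
      have h1 : B.codDeath B.essential ≤ t := ht.1
      rw [(B.codDeath_eq_top _).2 rfl] at h1
      exact WithTop.coe_ne_top (top_le_iff.1 h1))).congr (by
    rintro ⟨i, hi⟩
    obtain ⟨b, hb⟩ := WithTop.ne_top_iff_exists.1 (B.codDeath_ne_top hi)
    ext t
    simp [mem_bar, ← hb])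

theorem isBarcode_ker : IsBarcode (kerModule f) fun J => B.count (J.right : WithTop ℝ) J.left := by
  convert isBarcode_of_intervalBasis B.kerBars fun i hi => (i.2 hi).elim using 2 with J
  rw [count, ← Set.ncard_image_of_injective _ Subtype.val_injective]
  congr 1
  ext i
  constructor
  · rintro ⟨h1, h2⟩
    exact ⟨⟨i, h1 ▸ WithTop.coe_ne_top⟩, ⟨by simp [h2], h1⟩, rfl⟩
  · rintro ⟨⟨i, hi⟩, ⟨h1, h2⟩, rfl⟩
    obtain ⟨b, hb⟩ := WithTop.ne_top_iff_exists.1 (B.codDeath_ne_top hi)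
    refine ⟨h2, ?_⟩
    rw [← h1]
    simp [← hb]

/-! ### Decompositions of kernel, image and cokernel -/

theorem nonempty_kerModule_iso {M : ℝ → ℝ → ℕ} (hM : ∀ a b, M a b = B.count a b) :
    Nonempty (kerModule f ≅
      directSum fun i : (Σ p : {p : ℝ × ℝ // 0 < p.2 ∧ p.2 < p.1}, Fin (M p.1.1 p.1.2)) =>
        kappaIco.{u} i.1.1.2 i.1.1.1) := by
  let R : {p : ℝ × ℝ // 0 < p.2 ∧ p.2 < p.1} → ι → Prop := fun p i =>
    B.domDeath i = (p.1.1 : WithTop ℝ) ∧ B.codDeath i = (p.1.2 : WithTop ℝ)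
  have hm : ∀ p : {p : ℝ × ℝ // 0 < p.2 ∧ p.2 < p.1}, M p.1.1 p.1.2 = {i | R p i}.ncard :=
    fun p => hM _ _
  have hR : ∀ {p q i}, R p i → R q i → p = q := fun h h' =>
    Subtype.ext (Prod.ext (WithTop.coe_injective (h.1.symm.trans h'.1))
      (WithTop.coe_injective (h.2.symm.trans h'.2)))
  let g := fun x => (⟨(enumFibers R hm x).1,
    Or.inl (by rw [(enumFibers R hm x).2.1]; exact WithTop.coe_ne_top)⟩ : B.DomIndex)
  have hg : ∀ x, R x.1 (g x) := fun x => (enumFibers R hm x).2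
  refine ⟨((B.kerIntervals.reindex g (fun x y h => enumFibers_injective hm hR
    (congrArg (fun x : B.DomIndex => x.1) h)) ?_).congr fun x => ?_).iso
      (IntervalBasis.directSum fun x : (Σ p : {p : ℝ × ℝ // 0 < p.2 ∧ p.2 < p.1},
        Fin (M p.1.1 p.1.2)) => Set.Ico x.1.1.2 x.1.1.1)⟩
  · rintro ⟨i, hi⟩ ⟨t, h1, h2⟩
    obtain ⟨b, hb⟩ := WithTop.ne_top_iff_exists.1 (ne_top_of_le_ne_top WithTop.coe_ne_top h1)
    have hdom : B.domDeath i ≠ ⊤ := fun h => by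
      obtain rfl := hi.resolve_left (not_not.2 h)
      exact WithTop.coe_ne_top (hb.trans ((B.codDeath_eq_top _).2 rfl))
    obtain ⟨a, ha⟩ := WithTop.ne_top_iff_exists.1 hdom
    have hlt : b < a := WithTop.coe_lt_coe.1 (hb.trans_lt (h1.trans_lt (h2.trans_eq ha.symm)))
    have hpos : 0 < b := WithTop.coe_lt_coe.1 ((B.codDeath_pos i).trans_eq hb.symm)
    obtain ⟨x, hx⟩ := exists_enumFibers_eq hm (t := ⟨(a, b), hpos, hlt⟩) (i := i)
      ⟨ha.symm, hb.symm⟩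
    exact ⟨x, Subtype.ext hx⟩
  · ext t
    simp [(hg x).1, (hg x).2]

theorem nonempty_imModule_iso {M : ℝ → ℝ → ℕ} (hM : ∀ a b, M a b = B.count a b) :
    Nonempty (imModule f ≅ directSumTwo
      (directSum fun i : (Σ p : {p : ℝ × ℝ // 0 < p.2 ∧ p.2 ≤ p.1}, Fin (M p.1.1 p.1.2)) =>
        kappa.{u} i.1.1.2)
      kappaInfty.{u}) := by
  let R : {p : ℝ × ℝ // 0 < p.2 ∧ p.2 ≤ p.1} → ι → Prop := fun p i =>
    B.domDeath i = (p.1.1 : WithTop ℝ) ∧ B.codDeath i = (p.1.2 : WithTop ℝ)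
  have hm : ∀ p : {p : ℝ × ℝ // 0 < p.2 ∧ p.2 ≤ p.1}, M p.1.1 p.1.2 = {i | R p i}.ncard :=
    fun p => hM _ _
  have hR : ∀ {p q i}, R p i → R q i → p = q := fun h h' =>
    Subtype.ext (Prod.ext (WithTop.coe_injective (h.1.symm.trans h'.1))
      (WithTop.coe_injective (h.2.symm.trans h'.2)))
  let g := fun x => (⟨(enumFibers R hm x).1,
    Or.inl (by rw [(enumFibers R hm x).2.1]; exact WithTop.coe_ne_top)⟩ : B.DomIndex)
  let g' := fun _ : Unit => (⟨B.essential, Or.inr rfl⟩ : B.DomIndex)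
  have hg : ∀ x, R x.1 (g x) := fun x => (enumFibers R hm x).2
  have hinj : Function.Injective (Sum.elim g g') := by
    refine Function.Injective.sumElim (fun x y h => enumFibers_injective hm hR
      (congrArg (fun x : B.DomIndex => x.1) h)) (fun _ _ _ => rfl) fun x _ h => ?_
    exact B.not_essential_of_codDeath_eq (hg x).2 (congrArg (fun x : B.DomIndex => x.1) h)
  refine ⟨((B.imIntervals.reindex (Sum.elim g g') hinj ?_).congr ?_).iso
      ((IntervalBasis.directSum fun x : (Σ p : {p : ℝ × ℝ // 0 < p.2 ∧ p.2 ≤ p.1},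
        Fin (M p.1.1 p.1.2)) => Set.Ico 0 x.1.1.2).directSumTwo
        (IntervalBasis.intervalModule (Set.Ici 0)))⟩
  · rintro ⟨i, hi⟩ -
    by_cases hie : i = B.essential
    · exact ⟨Sum.inr (), Subtype.ext hie.symm⟩
    have hdom := hi.resolve_right hie
    obtain ⟨a, ha⟩ := WithTop.ne_top_iff_exists.1 hdom
    obtain ⟨b, hb⟩ := WithTop.ne_top_iff_exists.1 (B.codDeath_ne_top hdom)
    have hle : b ≤ a := WithTop.coe_le_coe.1 (hb.trans_le ((B.codDeath_le i).trans_eq ha.symm))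
    have hpos : 0 < b := WithTop.coe_lt_coe.1 ((B.codDeath_pos i).trans_eq hb.symm)
    obtain ⟨x, hx⟩ := exists_enumFibers_eq hm (t := ⟨(a, b), hpos, hle⟩) (i := i)
      ⟨ha.symm, hb.symm⟩
    exact ⟨Sum.inl x, Subtype.ext hx⟩
  · rintro (x | _)
    · rw [Sum.elim_inl, Sum.elim_inl, (hg x).2, bar_coe]
    · rw [Sum.elim_inr, Sum.elim_inr, (B.codDeath_eq_top _).2 rfl, bar_top]

theorem nonempty_cokerModule_iso {N : ℝ → ℕ} (hN : ∀ b, N b = B.count ⊤ b) :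
    Nonempty (cokerModule f ≅
      directSum fun i : (Σ b : {b : ℝ // 0 < b}, Fin (N b.1)) => kappa.{u} i.1.1) := by
  let R : {b : ℝ // 0 < b} → ι → Prop := fun b i =>
    B.domDeath i = ⊤ ∧ B.codDeath i = (b.1 : WithTop ℝ)
  have hm : ∀ b : {b : ℝ // 0 < b}, N b.1 = {i | R b i}.ncard := fun b => hN _
  have hR : ∀ {p q i}, R p i → R q i → p = q := fun h h' =>
    Subtype.ext (WithTop.coe_injective (h.2.symm.trans h'.2))
  let g := fun x => (enumFibers R hm x).1
  have hg : ∀ x, R x.1 (g x) := fun x => (enumFibers R hm x).2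
  refine ⟨((B.cokerIntervals.reindex g (enumFibers_injective hm hR) ?_).congr fun x => ?_).iso
      (IntervalBasis.directSum fun x : (Σ b : {b : ℝ // 0 < b}, Fin (N b.1)) => Set.Ico 0 x.1.1)⟩
  · rintro i ⟨t, h1, h2⟩
    have hi : ¬ (B.domDeath i ≠ ⊤ ∨ i = B.essential) := fun hi => by
      rw [cokerDeath, if_pos hi] at h2
      exact not_le.2 h2 (WithTop.coe_le_coe.2 h1)
    obtain ⟨b, hb⟩ := WithTop.ne_top_iff_exists.1
      fun h => hi (Or.inr ((B.codDeath_eq_top i).1 h))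
    have hpos : 0 < b := WithTop.coe_lt_coe.1 ((B.codDeath_pos i).trans_eq hb.symm)
    obtain ⟨x, hx⟩ := exists_enumFibers_eq hm (t := ⟨b, hpos⟩) (i := i)
      ⟨not_not.1 fun h => hi (Or.inl h), hb.symm⟩
    exact ⟨x, hx⟩
  · rw [(B.cokerDeath_eq_iff x.1.2).2 (hg x), bar_coe]

end MatchedBasis

/-! ### Existence of matched bases -/

/-- A module generated at zero by a finite-dimensional space, whose kernels `ker(W_0 → W_t)` change
at finitely many times in `[0, T]` only, reach their new value at these times, and have codimension
one at `T`. In `exists_mem`, `S` contains the times of change. -/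
structure IsTame (W : PersistenceModule.{u}) (T : ℝ) : Prop extends GeneratedAtZero W where
  finite : Module.Finite (ZMod 2) (W.obj 0)
  nonneg : 0 ≤ T
  finrank_eq_one : Module.finrank (ZMod 2) (W.obj T) = 1
  exists_mem : ∃ S : Set ℝ, S.Finite ∧ S ⊆ Set.Icc 0 T ∧ ∀ (t : ℝ) (h : 0 ≤ t), ∃ s ∈ S, s ≤ t ∧
    ∀ (hs : 0 ≤ s), LinearMap.ker (structureMap W h) ≤ LinearMap.ker (structureMap W hs)

theorem ker_structureMap_mono (W : PersistenceModule.{u}) {s t : ℝ} (hs : 0 ≤ s) (h : s ≤ t) :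
    LinearMap.ker (structureMap W hs) ≤ LinearMap.ker (structureMap W (hs.trans h)) := by
  intro x hx
  rw [LinearMap.mem_ker] at hx ⊢
  rw [← structureMap_comp_apply W hs h, hx, map_zero]

theorem IsTame.ker_le {W : PersistenceModule.{u}} {T : ℝ} (hW : IsTame W T) {t : ℝ} (h : 0 ≤ t) :
    LinearMap.ker (structureMap W h) ≤ LinearMap.ker (structureMap W hW.nonneg) := by
  obtain ⟨S, -, hST, hS⟩ := hW.exists_mem
  obtain ⟨s, hs, -, hker⟩ := hS t h
  exact (hker (hST hs).1).trans (ker_structureMap_mono W (hST hs).1 (hST hs).2)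

/-- Every element has a first time at which it is zero, or is never zero: the time is attained because
the kernels change at finitely many times only, at each of which the new kernel is reached. -/
theorem IsTame.exists_deathTime {W : PersistenceModule.{u}} {T : ℝ} (hW : IsTame W T)
    (x : W.obj 0) : ∃ d : WithTop ℝ, ∀ (t : ℝ) (h : 0 ≤ t),
      x ∈ LinearMap.ker (structureMap W h) ↔ d ≤ t := by
  obtain ⟨S, hSfin, hST, hS⟩ := hW.exists_mem
  let D := {s ∈ S | ∃ h : 0 ≤ s, x ∈ LinearMap.ker (structureMap W h)}
  by_cases hD : D.Nonempty
  · obtain ⟨d, ⟨hdS, hd0, hd⟩, hmin⟩ := (hSfin.subset (Set.sep_subset _ _)).exists_minimal hD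
    refine ⟨d, fun t h => ⟨fun hx => ?_, fun hdt => ?_⟩⟩
    · obtain ⟨s, hs, hst, hker⟩ := hS t h
      have hsD : s ∈ D := ⟨hs, (hST hs).1, hker _ hx⟩
      have : d ≤ s := (le_total d s).elim id fun h' => hmin hsD h'
      exact WithTop.coe_le_coe.2 (this.trans hst)
    · exact ker_structureMap_mono W hd0 (WithTop.coe_le_coe.1 hdt) hd
  · refine ⟨⊤, fun t h => iff_of_false (fun hx => hD ?_) (not_le.2 (WithTop.coe_lt_top t))⟩
    obtain ⟨s, hs, -, hker⟩ := hS t h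
    exact ⟨s, hs, (hST hs).1, hker _ hx⟩

theorem isChain_ker (W : PersistenceModule.{u}) :
    IsChain (· ≤ ·) {P | ∃ (t : ℝ) (h : 0 ≤ t), P = LinearMap.ker (structureMap W h)} := by
  rintro _ ⟨s, hs, rfl⟩ _ ⟨t, ht, rfl⟩ -
  rcases le_total s t with h | h
  · exact Or.inl (ker_structureMap_mono W hs h)
  · exact Or.inr (ker_structureMap_mono W ht h)

theorem finrank_quotient_ker {W : PersistenceModule.{u}} {T : ℝ} (hW : IsTame W T) :
    Module.finrank (ZMod 2) (W.obj 0 ⧸ LinearMap.ker (structureMap W hW.nonneg)) = 1 := by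
  rw [((structureMap W hW.nonneg).quotKerEquivOfSurjective (hW.surjective _)).finrank_eq,
    hW.finrank_eq_one]

/-- If `f` is injective at time `0` and at the time `T` after which nothing changes, there is a matched
basis. Injectivity at `T` gives `f₀(V_0) ∩ ker(U_0 → U_T) = f₀(ker(V_0 → V_T))`, so that the one basis
vector in `f₀(V_0)` that survives in `V` is the one that survives in `U`. -/
theorem exists_matchedBasis {V U : PersistenceModule.{u}} {f : V ⟶ U} {T : ℝ}
    (hV : IsTame V T) (hU : IsTame U T) (h0 : Function.Injective (f.app 0).hom)
    (hT : Function.Injective (f.app T).hom) : ∃ n, Nonempty (MatchedBasis f (Fin n)) := by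
  have := hU.finite
  let K : ∀ t : ℝ, 0 ≤ t → Submodule (ZMod 2) (U.obj 0) := fun t h =>
    (LinearMap.ker (structureMap V h)).map (f.app 0).hom
  let L : ∀ t : ℝ, 0 ≤ t → Submodule (ZMod 2) (U.obj 0) := fun t h =>
    LinearMap.ker (structureMap U h)
  let A := LinearMap.range (f.app 0).hom
  have hKA : ∀ t h, K t h ≤ A := fun t h => LinearMap.map_le_range
  have hKL : ∀ t h, K t h ≤ L t h := by
    rintro t h _ ⟨x, hx, rfl⟩
    change structureMap U h _ = 0
    rw [← structureMap_naturality, LinearMap.mem_ker.1 hx, map_zero]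
  have hchain : IsChain (· ≤ ·) (insert A {P | ∃ t h, P = K t h}) := by
    refine IsChain.insert ?_ ?_
    · rintro _ ⟨s, hs, rfl⟩ _ ⟨t, ht, rfl⟩ -
      rcases le_total s t with h | h
      · exact Or.inl (Submodule.map_mono (ker_structureMap_mono V hs h))
      · exact Or.inr (Submodule.map_mono (ker_structureMap_mono V ht h))
    · rintro _ ⟨t, h, rfl⟩ -
      exact Or.inr (hKA t h)
  obtain ⟨n, e, he⟩ := exists_basis_adapted hchain (isChain_ker U)
  have heK : ∀ t h, K t h = coordSpan e {i | e i ∈ K t h} := fun t h =>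
    (he _ (Or.inl (Or.inr ⟨t, h, rfl⟩))).symm
  have heL : ∀ t h, L t h = coordSpan e {i | e i ∈ L t h} := fun t h =>
    (he _ (Or.inr ⟨t, h, rfl⟩)).symm
  have heA : A = coordSpan e {i | e i ∈ A} := (he _ (Or.inl (Or.inl rfl))).symm
  have hγ : ∀ i, ∃ d : WithTop ℝ, ∀ (t : ℝ) (h : 0 ≤ t), e i ∈ K t h ↔ d ≤ t := by
    intro i
    by_cases hi : e i ∈ A
    · obtain ⟨x, hx⟩ := hi
      obtain ⟨d, hd⟩ := hV.exists_deathTime x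
      refine ⟨d, fun t h => ?_⟩
      rw [← hd t h, ← hx]
      exact h0.mem_set_image
    · exact ⟨⊤, fun t h => iff_of_false (fun h' => hi (hKA t h h'))
        (not_le.2 (WithTop.coe_lt_top t))⟩
  choose γ hγ using hγ
  choose β hβ using fun i => hU.exists_deathTime (e i)
  have hβpos : ∀ i, 0 < β i := by
    refine fun i => not_le.1 fun h => e.ne_zero i ?_
    rw [← structureMap_refl_apply U (e i)]
    exact (hβ i 0 le_rfl).2 h
  have hγpos : ∀ i, 0 < γ i := by
    refine fun i => not_le.1 fun h => e.ne_zero i ?_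
    rw [← structureMap_refl_apply U (e i)]
    exact hKL 0 le_rfl ((hγ i 0 le_rfl).2 h)
  have hγtop : ∀ i, γ i = ⊤ ↔ e i ∉ K T hV.nonneg := by
    refine fun i => ⟨fun h => ?_, fun h => ?_⟩
    · rw [hγ, h]
      exact not_le.2 (WithTop.coe_lt_top T)
    · by_contra hi
      obtain ⟨d, hd⟩ := WithTop.ne_top_iff_exists.1 hi
      have hd0 : 0 ≤ d := WithTop.coe_le_coe.1 ((hγpos i).le.trans_eq hd.symm)
      exact h (Submodule.map_mono (hV.ker_le hd0) ((hγ i d hd0).2 hd.ge))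
  have hβtop : ∀ i, β i = ⊤ ↔ e i ∉ L T hV.nonneg := by
    refine fun i => ⟨fun h => ?_, fun h => ?_⟩
    · rw [hβ, h]
      exact not_le.2 (WithTop.coe_lt_top T)
    · by_contra hi
      obtain ⟨d, hd⟩ := WithTop.ne_top_iff_exists.1 hi
      have hd0 : 0 ≤ d := WithTop.coe_le_coe.1 ((hβpos i).le.trans_eq hd.symm)
      exact h (hU.ker_le hd0 ((hβ i d hd0).2 hd.ge))
  have hβγ : ∀ i, β i ≤ γ i := by
    intro i
    by_cases hi : γ i = ⊤
    · exact hi ▸ le_top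
    · obtain ⟨d, hd⟩ := WithTop.ne_top_iff_exists.1 hi
      have hd0 : 0 ≤ d := WithTop.coe_le_coe.1 ((hγpos i).le.trans_eq hd.symm)
      rw [← hd]
      exact (hβ i d hd0).1 (hKL d hd0 ((hγ i d hd0).2 hd.ge))
  have hAL : A ⊓ L T hV.nonneg ≤ K T hV.nonneg := by
    rintro _ ⟨⟨x, rfl⟩, hx⟩
    refine ⟨x, hT ?_, rfl⟩
    rw [structureMap_naturality, map_zero]
    exact hx
  -- Both kernels at `T` have codimension one, in `U_0` and in `V_0`.
  obtain ⟨i₀, hi₀⟩ : ∃ i₀, {i | e i ∉ L T hV.nonneg} = {i₀} := by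
    rw [← Set.ncard_eq_one]
    have h1 := Submodule.finrank_quotient_add_finrank (L T hV.nonneg)
    rw [finrank_quotient_ker hU, heL, finrank_coordSpan,
      Module.finrank_eq_nat_card_basis e, Nat.card_coe_set_eq] at h1
    have h2 := Set.ncard_add_ncard_compl {i | e i ∈ L T hV.nonneg}
    have h3 : {i | e i ∉ L T hV.nonneg} = {i | e i ∈ L T hV.nonneg}ᶜ := rfl
    rw [h3]
    exact Nat.add_left_cancel (h2.trans (h1.symm.trans (Nat.add_comm _ _)))
  obtain ⟨j₀, hj₀⟩ : ∃ j₀, {i | e i ∈ A} \ {i | e i ∈ K T hV.nonneg} = {j₀} := by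
    rw [← Set.ncard_eq_one]
    have := hV.finite
    have h1 := Submodule.finrank_quotient_add_finrank
      (LinearMap.ker (structureMap V hV.nonneg))
    have h2 := LinearMap.finrank_range_of_inj h0
    have h3 : Module.finrank (ZMod 2) (K T hV.nonneg) =
        Module.finrank (ZMod 2) (LinearMap.ker (structureMap V hV.nonneg)) :=
      LinearEquiv.finrank_eq (Submodule.equivMapOfInjective _ h0 _).symm
    change Module.finrank (ZMod 2) A = _ at h2
    rw [heA, finrank_coordSpan, Nat.card_coe_set_eq] at h2
    rw [heK, finrank_coordSpan, Nat.card_coe_set_eq] at h3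
    rw [finrank_quotient_ker hV] at h1
    have h4 := Set.ncard_sdiff_add_ncard_of_subset
      (show {i | e i ∈ K T hV.nonneg} ⊆ {i | e i ∈ A} from fun i hi => hKA _ _ hi)
    omega
  have hj₀' : j₀ ∈ {i | e i ∈ A} \ {i | e i ∈ K T hV.nonneg} := hj₀ ▸ rfl
  obtain rfl : j₀ = i₀ := by
    have : j₀ ∈ {i | e i ∉ L T hV.nonneg} := fun h => hj₀'.2 (hAL ⟨hj₀'.1, h⟩)
    rwa [hi₀] at this
  exact ⟨n, ⟨{
    domGenerated := hV.toGeneratedAtZero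
    codGenerated := hU.toGeneratedAtZero
    injective := h0
    basis := e
    domDeath := γ
    codDeath := β
    essential := j₀
    codDeath_le := hβγ
    codDeath_pos := hβpos
    codDeath_eq_top := fun i => (hβtop i).trans (Set.ext_iff.1 hi₀ i)
    map_ker := fun t h => by
      refine (heK t h).trans ?_
      simp only [hγ]
    ker := fun t h => by
      refine (heL t h).trans ?_
      simp only [L, hβ]
    range := by
      refine heA.trans ?_
      congr 1
      ext i
      refine ⟨fun hi => ?_, fun hi => hi.elim (fun h => ?_) (fun h => h ▸ hj₀'.1)⟩
      · by_cases hK : e i ∈ K T hV.nonneg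
        · exact Or.inl fun h => (hγtop i).1 h hK
        · exact Or.inr (Set.ext_iff.1 hj₀ i |>.1 ⟨hi, hK⟩)
      · exact hKA _ _ (not_not.1 fun h' => h ((hγtop i).2 h')) }⟩⟩

/-! ### Degree-zero persistent homology -/

section PH0

variable (Z : Type u) [MetricSpace Z]

theorem generatedAtZero_PH0 : GeneratedAtZero (PH0 Z) where
  subsingleton_of_neg {t} h := by
    have : IsEmpty (vrGraph Z t).ConnectedComponent :=
      ⟨fun c => by
        induction c using SimpleGraph.ConnectedComponent.ind with
        | h v => exact not_le.2 h v.2⟩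
    exact inferInstanceAs (Subsingleton ((vrGraph Z t).ConnectedComponent →₀ ZMod 2))
  surjective {t} h := by
    refine Finsupp.mapDomain_surjective fun c => ?_
    induction c using SimpleGraph.ConnectedComponent.ind with
    | h v => exact ⟨(vrGraph Z 0).connectedComponentMk ⟨v.1, le_rfl⟩, rfl⟩

theorem vrComponentMap_injective_of_dist {s t : ℝ} (h : s ≤ t) (hs : 0 ≤ s)
    (hd : ∀ x y : Z, dist x y ≤ t → dist x y ≤ s) :
    Function.Injective (vrComponentMap (id : Z → Z) (fun _ _ => le_rfl) h) := by
  let g : (vrGraph Z t).ConnectedComponent → (vrGraph Z s).ConnectedComponent :=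
    componentMap (fun x => ⟨x.1, hs⟩) fun x y hxy =>
      Or.inr ⟨fun e => hxy.1 (Subtype.ext (congrArg (fun z => z.1) e)), hd _ _ hxy.2⟩
  refine Function.LeftInverse.injective (g := g) fun c => ?_
  induction c using SimpleGraph.ConnectedComponent.ind
  rfl

/-- The kernel does not change between `s` and `t` if no distance lies in `(s, t]`. -/
theorem ker_structureMap_PH0_le {s t : ℝ} (hs : 0 ≤ s) (h : s ≤ t)
    (hd : ∀ x y : Z, dist x y ≤ t → dist x y ≤ s) :
    LinearMap.ker (structureMap (PH0 Z) (hs.trans h)) ≤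
      LinearMap.ker (structureMap (PH0 Z) hs) := by
  intro x hx
  have hinj : Function.Injective (structureMap (PH0 Z) h) :=
    Finsupp.mapDomain_injective (vrComponentMap_injective_of_dist Z h hs hd)
  refine hinj ?_
  rw [structureMap_comp_apply, LinearMap.mem_ker.1 hx, map_zero]

theorem mk_eq_mk_of_dist_le {t : ℝ} (hd : ∀ x y : Z, dist x y ≤ t)
    (c d : (vrGraph Z t).ConnectedComponent) : c = d := by
  induction c using SimpleGraph.ConnectedComponent.ind with
  | h v =>
  induction d using SimpleGraph.ConnectedComponent.ind with
  | h w =>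
  by_cases hvw : v = w
  · rw [hvw]
  · exact SimpleGraph.ConnectedComponent.sound (SimpleGraph.Adj.reachable ⟨hvw, hd _ _⟩)

theorem isTame_PH0 [Finite Z] [Nonempty Z] {T : ℝ} (hT : 0 ≤ T) (hd : ∀ x y : Z, dist x y ≤ T) :
    IsTame (PH0 Z) T where
  toGeneratedAtZero := generatedAtZero_PH0 Z
  finite := by
    have : Finite (vrGraph Z 0).ConnectedComponent := Quot.finite _
    exact inferInstanceAs (Module.Finite (ZMod 2) ((vrGraph Z 0).ConnectedComponent →₀ ZMod 2))
  nonneg := hT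
  finrank_eq_one := by
    have : Subsingleton (vrGraph Z T).ConnectedComponent := ⟨mk_eq_mk_of_dist_le Z hd⟩
    have : Nonempty (vrGraph Z T).ConnectedComponent :=
      ⟨(vrGraph Z T).connectedComponentMk ⟨Classical.arbitrary Z, hT⟩⟩
    have := uniqueOfSubsingleton (Classical.arbitrary (vrGraph Z T).ConnectedComponent)
    exact (Module.finrank_finsupp_self (ZMod 2)).trans Fintype.card_unique
  exists_mem := by
    refine ⟨Set.range fun p : Z × Z => dist p.1 p.2, Set.finite_range _, ?_, fun t h => ?_⟩
    · rintro _ ⟨p, rfl⟩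
      exact ⟨dist_nonneg, hd _ _⟩
    · have z := Classical.arbitrary Z
      have : Nonempty {p : Z × Z // dist p.1 p.2 ≤ t} := ⟨⟨(z, z), (dist_self z).trans_le h⟩⟩
      obtain ⟨⟨p, hp⟩, hmax⟩ := Finite.exists_max
        fun p : {p : Z × Z // dist p.1 p.2 ≤ t} => dist p.1.1 p.1.2
      exact ⟨_, ⟨p, rfl⟩, hp, fun hs => ker_structureMap_PH0_le Z hs hp fun x y hxy =>
        hmax ⟨(x, y), hxy⟩⟩

theorem vrGraph_zero : vrGraph Z 0 = ⊥ := by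
  ext x y
  refine iff_of_false (fun h => h.1 (Subtype.ext ?_)) (by simp)
  exact dist_le_zero.1 h.2

end PH0

theorem injective_PH0map_zero {X Z : Type u} [MetricSpace X] [MetricSpace Z] {φ : X → Z}
    (hφ : ∀ x y, dist (φ x) (φ y) ≤ dist x y) (hinj : Function.Injective φ) :
    Function.Injective ((PH0map φ hφ).app 0).hom := by
  refine Finsupp.mapDomain_injective fun c d h => ?_
  induction c using SimpleGraph.ConnectedComponent.ind with
  | h v =>
  induction d using SimpleGraph.ConnectedComponent.ind with
  | h w =>
  have hr : (vrGraph Z 0).Reachable ⟨φ v.1, v.2⟩ ⟨φ w.1, w.2⟩ :=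
    SimpleGraph.ConnectedComponent.exact h
  rw [vrGraph_zero, SimpleGraph.reachable_bot] at hr
  rw [Subtype.ext (hinj (congrArg Subtype.val hr))]

theorem injective_PH0map_of_dist_le {X Z : Type u} [MetricSpace X] [MetricSpace Z] {φ : X → Z}
    (hφ : ∀ x y, dist (φ x) (φ y) ≤ dist x y) {T : ℝ} (hd : ∀ x y : X, dist x y ≤ T) :
    Function.Injective ((PH0map φ hφ).app T).hom :=
  Finsupp.mapDomain_injective fun c d _ => mk_eq_mk_of_dist_le X hd c d

theorem exists_dist_le (Z : Type u) [MetricSpace Z] [Finite Z] : ∃ T, ∀ x y : Z, dist x y ≤ T := by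
  obtain ⟨T, hT⟩ := (Set.finite_range fun p : Z × Z => dist p.1 p.2).bddAbove
  exact ⟨T, fun x y => hT ⟨(x, y), rfl⟩⟩

end Persistence
end

open Persistence in
theorem proposition4p5 {X Z : Type u} [MetricSpace X] [Finite X] [Nonempty X]
    [MetricSpace Z] [Finite Z] (φ : X → Z)
    (hφ : ∀ x y, dist (φ x) (φ y) ≤ dist x y) (hinj : Function.Injective φ) :
    let V : PersistenceModule.{u} := PH0 X
    let U : PersistenceModule.{u} := PH0 Z
    let f : V ⟶ U := PH0map φ hφ
    let f₀ : V.obj 0 →ₗ[ZMod 2] U.obj 0 := (f.app 0).hom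
    let M : ℝ → ℝ → ℕ := blockFunction f₀
    let N : ℝ → ℕ := unmatched f₀
    let D : WithTop ℝ → ℝ → ℕ := matchingDiagram f₀
    -- the sums below are finite, and the difference which defines `N` is not truncated
    {p : WithTop ℝ × ℝ | D p.1 p.2 ≠ 0}.Finite ∧
    (∀ (b : ℝ) (hb : 0 < b), (∑ᶠ (a : ℝ) (_ : 0 < a), M a b) ≤ barcode U ⟨0, b, hb⟩) ∧
    -- interval decompositions of the image, the kernel and the cokernel
    Nonempty (imModule f ≅ directSumTwo
      (directSum fun i : (Σ p : {p : ℝ × ℝ // 0 < p.2 ∧ p.2 ≤ p.1}, Fin (M p.1.1 p.1.2)) =>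
        kappa.{u} i.1.1.2)
      kappaInfty.{u}) ∧
    Nonempty (kerModule f ≅
      directSum fun i : (Σ p : {p : ℝ × ℝ // 0 < p.2 ∧ p.2 < p.1}, Fin (M p.1.1 p.1.2)) =>
        kappaIco.{u} i.1.1.2 i.1.1.1) ∧
    Nonempty (cokerModule f ≅
      directSum fun i : (Σ b : {b : ℝ // 0 < b}, Fin (N b.1)) => kappa.{u} i.1.1) ∧
    -- the matching diagram `D` encodes the barcodes of `V`, `U`, the kernel, image and cokernel
    IsBarcode V (fun J => if J.left = 0 then
      ∑ᶠ (b : ℝ) (_ : b ≤ J.right), D (J.right : WithTop ℝ) b else 0) ∧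
    IsBarcode U (fun J => if J.left = 0 then
      ∑ᶠ (a : WithTop ℝ) (_ : (J.right : WithTop ℝ) ≤ a), D a J.right else 0) ∧
    IsBarcode (kerModule f) (fun J => D (J.right : WithTop ℝ) J.left) ∧
    IsBarcode (imModule f) (fun J => if J.left = 0 then
      ∑ᶠ (a : ℝ) (_ : J.right ≤ a), D (a : WithTop ℝ) J.right else 0) ∧
    IsBarcode (cokerModule f) (fun J => if J.left = 0 then D ⊤ J.right else 0) := by
  intro V U f f₀ M N D
  have : Nonempty Z := ⟨φ (Classical.arbitrary X)⟩
  obtain ⟨T₁, hT₁⟩ := exists_dist_le X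
  obtain ⟨T₂, hT₂⟩ := exists_dist_le Z
  have hX : ∀ x y : X, dist x y ≤ max T₁ T₂ := fun x y => (hT₁ x y).trans (le_max_left _ _)
  have hZ : ∀ x y : Z, dist x y ≤ max T₁ T₂ := fun x y => (hT₂ x y).trans (le_max_right _ _)
  have hT : 0 ≤ max T₁ T₂ := by
    have x := Classical.arbitrary X
    exact (dist_self x).ge.trans (hX x x)
  obtain ⟨n, ⟨B⟩⟩ := exists_matchedBasis (f := f) (isTame_PH0 X hT hX) (isTame_PH0 Z hT hZ)
    (injective_PH0map_zero hφ hinj) (injective_PH0map_of_dist_le hφ hX)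
  have hM : ∀ a b, M a b = B.count a b := B.blockFunction_eq
  have hN : ∀ b, N b = B.count ⊤ b := B.unmatched_eq
  have hD : ∀ a b, D a b = B.count a b := B.matchingDiagram_eq
  refine ⟨?_, fun b hb => ?_, B.nonempty_imModule_iso hM, B.nonempty_kerModule_iso hM,
    B.nonempty_cokerModule_iso hN, ?_, ?_, ?_, ?_, ?_⟩
  · simpa only [hD] using B.finite_support_count
  · rw [B.barcode_cod hb, B.ncard_eq_add_count_top]
    simp only [hM]
    exact Nat.le_add_right _ _
  · simpa only [hD] using B.isBarcode_dom
  · simpa only [hD] using B.isBarcode_cod_count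
  · simpa only [hD] using B.isBarcode_ker
  · simpa only [hD] using B.isBarcode_im
  · simpa only [hD] using B.isBarcode_coker
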